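/- Let $M$ be a von Neumann algebra of operators on a complex Hilbert space $H$, with commutant $M'$ and center $Z(M)=M\cap M'$, and let $\tau$ be a faithful normal finite trace on $M$, with restriction $\tau_Z$ to $Z(M)$. A linear operator $x$ on $H$ with domain $\mathcal D(x)$ is affiliated with $M$ if $u(\mathcal D(x))\subset \mathcal D(x)$ and $ux\xi=xu\xi$ for every unitary $u\in M'$ and $\xi\in\mathcal D(x)$. The set $S(M,\tau)$ of $\tau$-measurable operators consists of the closed operators $x$ affiliated with $M$ such that for every $\varepsilon>0$ there is a projection $p\in M$ with $p(H)\subset\mathcal D(x)$ and $\tau(1-p)<\varepsilon$; it is a $*$-algebra under strong sum and strong product (the closures of the algebraic sum and product). A Young function is a function $\phi(t)=\int_0^t\varphi(s)\,ds$, $t\ge 0$, where $\varphi:[0,\infty)\to[0,\infty)$ is right continuous, nondecreasing on $(0,\infty)$, $\varphi(0)=0$, $\varphi(s)>0$ for $s>0$ and $\lim_{s\to\infty}\varphi(s)=\infty$. Write $\phi_1\prec\phi_2$ if there are constants $c,T\ge0$ with $\phi_1(t)\le\phi_2(ct)$ for all $t\ge T$. A nonempty set $\Lambda$ of Young functions is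 a quadratic family if for all $\phi_1,\phi_2\in\Lambda$ there is $\psi\in\Lambda$ with $\phi_1,\phi_2\prec\psi$, and for every $\phi\in\Lambda$ there are $\psi\in\Lambda$, $c>0$ and $T\ge0$ with $\phi(t^2)\le\psi(ct)$ for all $t\ge T$. For a Young function $\phi$ put $K_\phi(M,\tau)=\{x\in S(M,\tau):\tau(\phi(|x|))\le1\}$, where $\tau(\phi(|x|))=\int_{[0,\infty)}\phi(t)\,d\tau(E(t))\in[0,\infty]$ and $E$ is the spectral measure of $|x|=(x^*x)^{1/2}$. Put $L_\phi(M,\tau)=\bigcup_{n\ge1}nK_\phi(M,\tau)$ and $L^\Lambda(M,\tau)=\bigcap_{\phi\in\Lambda}L_\phi(M,\tau)$. Then, for every quadratic family $\Lambda$ of Young functions, the center of $L^\Lambda(M,\tau)$, that is, the set of all $x\in L^\Lambda(M,\tau)$ whose strong product with every $y\in L^\Lambda(M,\tau)$ satisfies $xy=yx$, is $$Z(L^\Lambda(M,\tau))=L^\Lambda(Z(M),\tau_Z),$$ an equality of sets of closed operators on $H$. -/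

import Mathlib

open MeasureTheory Filter Topology
open scoped NNReal ENNReal InnerProductSpace Pointwise

noncomputable section

namespace GenArens

variable {H : Type*} [NormedAddCommGroup H] [InnerProductSpace ℂ H] [CompleteSpace H]

/-! ### Von Neumann algebras: center and traces -/

/-- The center `Z(M) = M ∩ M'` of a von Neumann algebra, as a von Neumann algebra on the same
Hilbert space. -/
def center (M : VonNeumannAlgebra H) : VonNeumannAlgebra H where
  toStarSubalgebra := M.toStarSubalgebra ⊓ M.commutant.toStarSubalgebra
  centralizer_centralizer' := by
    apply Set.Subset.antisymm
    · intro x hx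
      refine ⟨?_, ?_⟩
      · have h1 : x ∈ Set.centralizer (Set.centralizer (M : Set (H →L[ℂ] H))) :=
          Set.centralizer_subset (Set.centralizer_subset fun _ h => h.1) hx
        rwa [M.centralizer_centralizer] at h1
      · have h1 : x ∈ Set.centralizer (Set.centralizer (M.commutant : Set (H →L[ℂ] H))) :=
          Set.centralizer_subset (Set.centralizer_subset fun _ h => h.2) hx
        rwa [M.commutant.centralizer_centralizer] at h1
    · exact Set.subset_centralizer_centralizer

theorem mem_center_iff {M : VonNeumannAlgebra H} {x : H →L[ℂ] H} :
    x ∈ center M ↔ x ∈ M ∧ x ∈ M.commutant := Iff.rfl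

theorem center_le (M : VonNeumannAlgebra H) :
    (center M).toStarSubalgebra ≤ M.toStarSubalgebra := fun _ h => h.1

/-- A faithful normal finite trace on `M`, given as a linear functional on `M`.
Positivity refers to the usual order of bounded operators. Normality: `τ` preserves suprema of
upward directed sets of positive elements. (A bounded directed set in `M` has a supremum in
`B(H)`, which lies in `M` and is its supremum in `M` as well.) -/
structure FaithfulNormalFiniteTrace (M : VonNeumannAlgebra H) where
  toLinearMap : M.toStarSubalgebra →ₗ[ℂ] ℂ
  re_nonneg : ∀ a : M.toStarSubalgebra, 0 ≤ (a : H →L[ℂ] H) → 0 ≤ (toLinearMap a).re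
  im_eq_zero : ∀ a : M.toStarSubalgebra, 0 ≤ (a : H →L[ℂ] H) → (toLinearMap a).im = 0
  tracial : ∀ a : M.toStarSubalgebra, toLinearMap (star a * a) = toLinearMap (a * star a)
  faithful : ∀ a : M.toStarSubalgebra, 0 ≤ (a : H →L[ℂ] H) → toLinearMap a = 0 → a = 0
  normal : ∀ (D : Set M.toStarSubalgebra) (a : M.toStarSubalgebra), D.Nonempty →
    (∀ b ∈ D, 0 ≤ (b : H →L[ℂ] H)) →
    DirectedOn (fun b c : M.toStarSubalgebra => (b : H →L[ℂ] H) ≤ (c : H →L[ℂ] H)) D →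
    IsLUB ((fun b : M.toStarSubalgebra => (b : H →L[ℂ] H)) '' D) (a : H →L[ℂ] H) →
    IsLUB ((fun b => (toLinearMap b).re) '' D) (toLinearMap a).re

/-- The restriction `τ_N` of a trace to a von Neumann subalgebra `N ⊆ M`. -/
def FaithfulNormalFiniteTrace.restrict {M : VonNeumannAlgebra H}
    (τ : FaithfulNormalFiniteTrace M) (N : VonNeumannAlgebra H)
    (h : N.toStarSubalgebra ≤ M.toStarSubalgebra) : FaithfulNormalFiniteTrace N where
  toLinearMap := τ.toLinearMap ∘ₗ (StarSubalgebra.inclusion h).toAlgHom.toLinearMap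
  re_nonneg a ha := τ.re_nonneg _ ha
  im_eq_zero a ha := τ.im_eq_zero _ ha
  tracial a := τ.tracial (StarSubalgebra.inclusion h a)
  faithful a ha h0 := by
    have := τ.faithful (StarSubalgebra.inclusion h a) ha h0
    exact Subtype.ext (congrArg (fun b : M.toStarSubalgebra => (b : H →L[ℂ] H)) this)
  normal D a hne hpos hdir hlub := by
    have := τ.normal (StarSubalgebra.inclusion h '' D) (StarSubalgebra.inclusion h a)
      (hne.image _) (by rintro _ ⟨b, hb, rfl⟩; exact hpos b hb)
      (by
        rintro _ ⟨b, hb, rfl⟩ _ ⟨c, hc, rfl⟩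
        obtain ⟨d, hd, h1, h2⟩ := hdir b hb c hc
        exact ⟨_, ⟨d, hd, rfl⟩, h1, h2⟩)
      (by rw [Set.image_image]; exact hlub)
    rw [Set.image_image] at this
    exact this

/-! ### Unbounded operators -/

/-- The product `xy` of two unbounded operators, on its natural domain
`{ξ ∈ D(y) : y ξ ∈ D(x)}`. -/
def comp (x y : H →ₗ.[ℂ] H) : H →ₗ.[ℂ] H where
  domain := (x.domain.comap y.toFun).map y.domain.subtype
  toFun :=
    { toFun := fun ξ => x ⟨y ⟨ξ, by
          obtain ⟨η, _, h⟩ := ξ.2; exact h ▸ η.2⟩, by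
          obtain ⟨ξ, η, hη, rfl⟩ := ξ; exact hη⟩
      map_add' := fun ξ η => by
        rw [← LinearPMap.map_add]; congr 1; apply Subtype.ext
        exact LinearPMap.map_add y ⟨ξ, _⟩ ⟨η, _⟩
      map_smul' := fun c ξ => by
        rw [RingHom.id_apply, ← LinearPMap.map_smul]; congr 1; apply Subtype.ext
        exact LinearPMap.map_smul y c ⟨ξ, _⟩ }

theorem mem_comp_domain {x y : H →ₗ.[ℂ] H} {ξ : H} :
    ξ ∈ (comp x y).domain ↔ ∃ h : ξ ∈ y.domain, y ⟨ξ, h⟩ ∈ x.domain := by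
  constructor
  · rintro ⟨η, hη, rfl⟩; exact ⟨η.2, hη⟩
  · rintro ⟨h, h'⟩; exact ⟨⟨ξ, h⟩, h', rfl⟩

theorem comp_apply {x y : H →ₗ.[ℂ] H} {ξ : H} (h : ξ ∈ (comp x y).domain) (hy : ξ ∈ y.domain)
    (hx : y ⟨ξ, hy⟩ ∈ x.domain) : comp x y ⟨ξ, h⟩ = x ⟨y ⟨ξ, hy⟩, hx⟩ := rfl

/-- The strong product of two unbounded operators: the closure of their product. -/
def strongMul (x y : H →ₗ.[ℂ] H) : H →ₗ.[ℂ] H := (comp x y).closure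

/-- `x` is affiliated with `M`: every unitary `u` of the commutant `M'` maps the domain of `x`
into itself and commutes with `x` there. -/
def Affiliated (M : VonNeumannAlgebra H) (x : H →ₗ.[ℂ] H) : Prop :=
  ∀ u ∈ unitary (H →L[ℂ] H), u ∈ M.commutant → ∀ ξ : x.domain,
    ∃ h : u (ξ : H) ∈ x.domain, u (x ξ) = x ⟨u (ξ : H), h⟩

/-- The set `S(M, τ)` of `τ`-measurable operators: closed operators affiliated with `M` whose
domain is `τ`-dense. -/
def measurableOperators (M : VonNeumannAlgebra H) (τ : FaithfulNormalFiniteTrace M) :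
    Set (H →ₗ.[ℂ] H) :=
  {x | x.IsClosed ∧ Affiliated M x ∧
    ∀ ε : ℝ, 0 < ε → ∃ p : M.toStarSubalgebra, IsStarProjection (p : H →L[ℂ] H) ∧
      (∀ ξ : H, (p : H →L[ℂ] H) ξ ∈ x.domain) ∧ (τ.toLinearMap (1 - p)).re < ε}

/-- `a` is the absolute value `|x| = (x* x)^{1/2}`: the positive self-adjoint operator
with `a² = x* x`. -/
structure IsAbs (a x : H →ₗ.[ℂ] H) : Prop where
  isSelfAdjoint : IsSelfAdjoint a
  nonneg : ∀ ξ : a.domain, 0 ≤ (⟪(ξ : H), a ξ⟫_ℂ).re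
  sq_eq : comp a a = comp x.adjoint x

/-! ### Projection-valued measures and the spectral resolution of a positive operator -/

/-- A projection-valued Borel measure on `[0, ∞)` with values in the projections of `M`,
countably additive in the strong operator topology. -/
structure ProjMeasure (M : VonNeumannAlgebra H) where
  proj : Set ℝ≥0 → M.toStarSubalgebra
  isStarProjection : ∀ s, MeasurableSet s → IsStarProjection (proj s : H →L[ℂ] H)
  proj_univ : proj Set.univ = 1
  hasSum : ∀ s : ℕ → Set ℝ≥0, (∀ i, MeasurableSet (s i)) → Pairwise (Function.onFun Disjoint s) →
    ∀ ξ : H, HasSum (fun i => (proj (s i) : H →L[ℂ] H) ξ) ((proj (⋃ i, s i) : H →L[ℂ] H) ξ)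

namespace ProjMeasure

variable {M : VonNeumannAlgebra H} (E : ProjMeasure M)

theorem proj_empty : E.proj ∅ = 0 := by
  apply Subtype.ext
  ext ξ
  have h := E.hasSum (fun _ => ∅) (fun _ => MeasurableSet.empty)
    (fun _ _ _ => by simp [Function.onFun]) ξ
  have h0 := h.summable.tendsto_atTop_zero
  exact tendsto_nhds_unique tendsto_const_nhds h0

theorem proj_nonneg {s : Set ℝ≥0} (hs : MeasurableSet s) : 0 ≤ (E.proj s : H →L[ℂ] H) :=
  (E.isStarProjection s hs).nonneg

theorem inner_nonneg {s : Set ℝ≥0} (hs : MeasurableSet s) (ξ : H) :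
    0 ≤ (⟪ξ, (E.proj s : H →L[ℂ] H) ξ⟫_ℂ).re :=
  ((ContinuousLinearMap.nonneg_iff_isPositive _).1 (E.proj_nonneg hs)).re_inner_nonneg_right ξ

theorem hasSum_inner {s : ℕ → Set ℝ≥0} (hs : ∀ i, MeasurableSet (s i))
    (hd : Pairwise (Function.onFun Disjoint s)) (ξ : H) :
    HasSum (fun i => (⟪ξ, (E.proj (s i) : H →L[ℂ] H) ξ⟫_ℂ).re)
      (⟪ξ, (E.proj (⋃ i, s i) : H →L[ℂ] H) ξ⟫_ℂ).re := by
  have h := (E.hasSum s hs hd ξ).mapL (innerSL ℂ ξ)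
  exact h.mapL Complex.reCLM

/-- The scalar measure `s ↦ ⟨E(s) ξ, ξ⟩`. -/
def scalar (ξ : H) : Measure ℝ≥0 :=
  Measure.ofMeasurable (fun s _ => ENNReal.ofReal (⟪ξ, (E.proj s : H →L[ℂ] H) ξ⟫_ℂ).re)
    (by simp [E.proj_empty])
    (fun s hs hd => by
      have h := E.hasSum_inner hs hd ξ
      rw [← ENNReal.ofReal_tsum_of_nonneg (fun i => E.inner_nonneg (hs i) ξ) h.summable,
        h.tsum_eq])

theorem scalar_apply (ξ : H) {s : Set ℝ≥0} (hs : MeasurableSet s) :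
    E.scalar ξ s = ENNReal.ofReal (⟪ξ, (E.proj s : H →L[ℂ] H) ξ⟫_ℂ).re :=
  Measure.ofMeasurable_apply s hs

theorem hasSum_trace (τ : FaithfulNormalFiniteTrace M) {s : ℕ → Set ℝ≥0}
    (hs : ∀ i, MeasurableSet (s i)) (hd : Pairwise (Function.onFun Disjoint s)) :
    HasSum (fun i => (τ.toLinearMap (E.proj (s i))).re)
      (τ.toLinearMap (E.proj (⋃ i, s i))).re := by
  set P : ℕ → M.toStarSubalgebra := fun n => ∑ i ∈ Finset.range n, E.proj (s i) with hP
  have hPc : ∀ n, (P n : H →L[ℂ] H) = ∑ i ∈ Finset.range n, (E.proj (s i) : H →L[ℂ] H) := by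
    intro n; simp [hP]
  have hmono : Monotone (fun n => (P n : H →L[ℂ] H)) := by
    refine monotone_nat_of_le_succ fun n => ?_
    simp only [hPc, Finset.sum_range_succ]
    exact le_add_of_nonneg_right (E.proj_nonneg (hs n))
  have hP0 : ∀ n, 0 ≤ (P n : H →L[ℂ] H) := fun n => by
    rw [hPc]; exact Finset.sum_nonneg fun i _ => E.proj_nonneg (hs i)
  have hPin : ∀ n ξ, (⟪ξ, (P n : H →L[ℂ] H) ξ⟫_ℂ).re =
      ∑ i ∈ Finset.range n, (⟪ξ, (E.proj (s i) : H →L[ℂ] H) ξ⟫_ℂ).re := by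
    intro n ξ
    rw [hPc]; simp
  have hsub : ∀ (A B : H →L[ℂ] H), 0 ≤ A → 0 ≤ B →
      (A ≤ B ↔ ∀ ξ, (⟪ξ, A ξ⟫_ℂ).re ≤ (⟪ξ, B ξ⟫_ℂ).re) := by
    intro A B hA hB
    rw [ContinuousLinearMap.nonneg_iff_isPositive] at hA hB
    rw [ContinuousLinearMap.le_def]
    constructor
    · intro h ξ
      have h1 : 0 ≤ (⟪ξ, (B - A) ξ⟫_ℂ).re := h.re_inner_nonneg_right ξ
      rw [sub_apply, inner_sub_right, Complex.sub_re] at h1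
      linarith
    · intro h
      rw [ContinuousLinearMap.isPositive_def']
      refine ⟨hB.isSelfAdjoint.sub hA.isSelfAdjoint, fun ξ => ?_⟩
      rw [ContinuousLinearMap.reApplyInnerSelf_apply, inner_re_symm,
        sub_apply, inner_sub_right, map_sub]
      exact sub_nonneg.2 (h ξ)
  have hU : 0 ≤ (E.proj (⋃ i, s i) : H →L[ℂ] H) := E.proj_nonneg (MeasurableSet.iUnion hs)
  have hlub : IsLUB ((fun b : M.toStarSubalgebra => (b : H →L[ℂ] H)) '' Set.range P)
      (E.proj (⋃ i, s i) : H →L[ℂ] H) := by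
    constructor
    · rintro _ ⟨_, ⟨n, rfl⟩, rfl⟩
      refine (hsub _ _ (hP0 n) hU).2 fun ξ => ?_
      rw [hPin]
      exact sum_le_hasSum _ (fun i _ => E.inner_nonneg (hs i) ξ) (E.hasSum_inner hs hd ξ)
    · intro c hc
      have hc' : ∀ n, (P n : H →L[ℂ] H) ≤ c := fun n => hc ⟨_, ⟨n, rfl⟩, rfl⟩
      have hc0 : 0 ≤ c := (hP0 0).trans (hc' 0)
      refine (hsub _ _ hU hc0).2 fun ξ => ?_
      refine le_of_tendsto' (E.hasSum_inner hs hd ξ).tendsto_sum_nat fun n => ?_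
      rw [← hPin]
      exact (hsub _ _ (hP0 n) hc0).1 (hc' n) ξ
  have h := τ.normal (Set.range P) (E.proj (⋃ i, s i)) ⟨_, ⟨0, rfl⟩⟩
    (by rintro _ ⟨n, rfl⟩; exact hP0 n)
    (by
      rintro _ ⟨n, rfl⟩ _ ⟨m, rfl⟩
      exact ⟨_, ⟨max n m, rfl⟩, hmono (le_max_left n m), hmono (le_max_right n m)⟩)
    hlub
  have hnn : ∀ i, 0 ≤ (τ.toLinearMap (E.proj (s i))).re := fun i =>
    τ.re_nonneg _ (E.proj_nonneg (hs i))
  rw [hasSum_iff_tendsto_nat_of_nonneg hnn]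
  have hsum : ∀ n, ∑ i ∈ Finset.range n, (τ.toLinearMap (E.proj (s i))).re =
      (τ.toLinearMap (P n)).re := by
    intro n; simp [hP]
  have hmon : Monotone fun n => ∑ i ∈ Finset.range n, (τ.toLinearMap (E.proj (s i))).re :=
    monotone_nat_of_le_succ fun n => by
      rw [Finset.sum_range_succ]; exact le_add_of_nonneg_right (hnn n)
  refine tendsto_atTop_isLUB hmon ?_
  simp only [hsum]
  rw [← Set.range_comp] at h
  exact h

/-- The scalar measure `s ↦ τ(E(s))`. -/
def traceMeasure (τ : FaithfulNormalFiniteTrace M) : Measure ℝ≥0 :=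
  Measure.ofMeasurable (fun s _ => ENNReal.ofReal (τ.toLinearMap (E.proj s)).re)
    (by simp [E.proj_empty])
    (fun s hs hd => by
      have h := E.hasSum_trace τ hs hd
      rw [← ENNReal.ofReal_tsum_of_nonneg
        (fun i => τ.re_nonneg _ (E.proj_nonneg (hs i))) h.summable, h.tsum_eq])

theorem traceMeasure_apply (τ : FaithfulNormalFiniteTrace M) {s : Set ℝ≥0}
    (hs : MeasurableSet s) :
    E.traceMeasure τ s = ENNReal.ofReal (τ.toLinearMap (E.proj s)).re :=
  Measure.ofMeasurable_apply s hs

/-- `E` is the spectral measure of the positive operator `a`, i.e. `a = ∫ t dE(t)`: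
`D(a) = {ξ | ∫ t² d⟨E(t)ξ, ξ⟩ < ∞}` and `⟨aξ, ξ⟩ = ∫ t d⟨E(t)ξ, ξ⟩` on `D(a)`.
By polarization the latter determines `a` on `D(a)`. -/
structure IsSpectralMeasureOf (E : ProjMeasure M) (a : H →ₗ.[ℂ] H) : Prop where
  mem_domain_iff : ∀ ξ : H, ξ ∈ a.domain ↔ ∫⁻ t, (t : ℝ≥0∞) ^ 2 ∂(E.scalar ξ) < ∞
  inner_eq : ∀ ξ : a.domain, ⟪(ξ : H), a ξ⟫_ℂ = ((∫ t, (t : ℝ) ∂(E.scalar (ξ : H)) : ℝ) : ℂ)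

end ProjMeasure

/-! ### Young functions and generalized Arens algebras -/

/-- Young functions `φ(t) = ∫₀ᵗ d(s) ds`, where `d : [0, ∞) → [0, ∞)` is right continuous,
nondecreasing on `(0, ∞)`, vanishes exactly at `0` and tends to infinity. -/
def IsYoung (φ : ℝ≥0 → ℝ≥0) : Prop :=
  ∃ d : ℝ≥0 → ℝ≥0, d 0 = 0 ∧ (∀ s, 0 < s → 0 < d s) ∧ Tendsto d atTop atTop ∧
    (∀ s, ContinuousWithinAt d (Set.Ici s) s) ∧ MonotoneOn d (Set.Ioi 0) ∧
    ∀ t : ℝ≥0, (φ t : ℝ) = ∫ s in (0 : ℝ)..t, (d s.toNNReal : ℝ)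

/-- `φ₁ ≺ φ₂`: there are constants `c, T ≥ 0` with `φ₁(t) ≤ φ₂(c t)` for all `t ≥ T`. -/
def Dominated (φ₁ φ₂ : ℝ≥0 → ℝ≥0) : Prop :=
  ∃ c T : ℝ≥0, ∀ t, T ≤ t → φ₁ t ≤ φ₂ (c * t)

/-- A quadratic (generating) family of Young functions. -/
structure IsQuadraticFamily (Λ : Set (ℝ≥0 → ℝ≥0)) : Prop where
  nonempty : Λ.Nonempty
  isYoung : ∀ φ ∈ Λ, IsYoung φ
  generating : ∀ φ₁ ∈ Λ, ∀ φ₂ ∈ Λ, ∃ ψ ∈ Λ, Dominated φ₁ ψ ∧ Dominated φ₂ ψ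
  quadratic : ∀ φ ∈ Λ, ∃ ψ ∈ Λ, ∃ c T : ℝ≥0, 0 < c ∧ ∀ t, T ≤ t → φ (t ^ 2) ≤ ψ (c * t)

/-- `K_φ = {x ∈ S(M, τ) : τ(φ(|x|)) ≤ 1}`. Here `τ(φ(|x|)) = ∫ φ(t) dτ(E(t)) ∈ [0, ∞]`, where
`E` is the spectral measure of `|x|`; both `|x|` and `E` are unique. -/
def orliczBall (M : VonNeumannAlgebra H) (τ : FaithfulNormalFiniteTrace M) (φ : ℝ≥0 → ℝ≥0) :
    Set (H →ₗ.[ℂ] H) :=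
  {x | x ∈ measurableOperators M τ ∧ ∃ (a : H →ₗ.[ℂ] H) (E : ProjMeasure M),
    IsAbs a x ∧ E.IsSpectralMeasureOf a ∧ ∫⁻ t, (φ t : ℝ≥0∞) ∂(E.traceMeasure τ) ≤ 1}

/-- The Orlicz space `L_φ(M, τ) = ⋃_{n ≥ 1} n K_φ`. -/
def orliczSpace (M : VonNeumannAlgebra H) (τ : FaithfulNormalFiniteTrace M) (φ : ℝ≥0 → ℝ≥0) :
    Set (H →ₗ.[ℂ] H) :=
  ⋃ n : ℕ, ⋃ _ : 1 ≤ n, (n : ℂ) • orliczBall M τ φ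

/-- The generalized Arens algebra `L^Λ(M, τ) = ⋂_{φ ∈ Λ} L_φ(M, τ)`. -/
def generalizedArens (M : VonNeumannAlgebra H) (τ : FaithfulNormalFiniteTrace M)
    (Λ : Set (ℝ≥0 → ℝ≥0)) : Set (H →ₗ.[ℂ] H) :=
  ⋂ φ ∈ Λ, orliczSpace M τ φ

/-- The center of a set of closed operators that is an algebra for the strong operations:
the elements whose strong product with every element of the set does not depend on the order. -/
def strongCenter (A : Set (H →ₗ.[ℂ] H)) : Set (H →ₗ.[ℂ] H) :=
  {x | x ∈ A ∧ ∀ y ∈ A, strongMul x y = strongMul y x}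

end GenArens

end

noncomputable section

namespace GenArens

variable {H : Type*} [NormedAddCommGroup H] [InnerProductSpace ℂ H] [CompleteSpace H]

/-! ### Bounded operators commuting with unbounded ones -/

/-! All commutation is phrased through graphs: a bounded `T` commutes with a closed `x` when `T × T`
maps the graph of `x` into itself (`Preserves`). Since `M` is spanned by its unitaries, testing
unitaries is enough.

Let `x` be central. Every unitary of `M` lies in each Orlicz space, because the trace is finite and
a Young function tends to `0` at `0` (`unitary_mem_orliczSpace`). So `x` commutes with the
unitaries, hence with all of `M`. Then `M` commutes with `x* x = |x|²`, and therefore with the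
spectral projections of `|x|` (`IsAbs.op_mul_comm`), which thus lie in `Z(M)`. With `e n = E([0,
n])`, the bounded operators `x (e n)` lie in `Z(M)` and approximate `x` on its domain, so `x` is
affiliated with `Z(M)`. The measure `τ ∘ E` is the same over both algebras, so the norm condition
carries over.

Conversely, let `x` come from `Z(M)` and `y` from `M`. Both are limits of such cutoffs: those of `x`
commute with `y`, those of `y` with `x`. Approximating shows that the graphs of `xy` and `yx` have
the same closure, and a cutoff argument shows that this closure is a graph (`strongMul_comm`).

A spectral measure is tied to its operator only by the domain and the quadratic form. Commutation
with spectral projections is therefore proved by hand, from norm bounds of `a` on spectral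
subspaces. -/

/-- The bounded operator `T` commutes with the unbounded operator `x`, i.e. `T x ⊆ x T`. -/
def Preserves (T : H →L[ℂ] H) (x : H →ₗ.[ℂ] H) : Prop :=
  ∀ ξ η : H, (ξ, η) ∈ x.graph → (T ξ, T η) ∈ x.graph

theorem mem_graph_comp {x y : H →ₗ.[ℂ] H} {ξ ζ : H} :
    (ξ, ζ) ∈ (comp x y).graph ↔ ∃ η, (ξ, η) ∈ y.graph ∧ (η, ζ) ∈ x.graph := by
  constructor
  · intro h
    obtain ⟨⟨ξ', h'⟩, rfl, rfl⟩ := (LinearPMap.mem_graph_iff _).1 h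
    obtain ⟨hy, hx⟩ := mem_comp_domain.1 h'
    exact ⟨_, y.mem_graph ⟨ξ', hy⟩, by rw [comp_apply h' hy hx]; exact x.mem_graph ⟨_, hx⟩⟩
  · rintro ⟨η, h1, h2⟩
    obtain ⟨⟨ξ', hy⟩, rfl, rfl⟩ := (LinearPMap.mem_graph_iff _).1 h1
    obtain ⟨⟨η', hx⟩, h3, rfl⟩ := (LinearPMap.mem_graph_iff _).1 h2
    simp only at h3
    subst h3
    exact (comp x y).mem_graph ⟨ξ', mem_comp_domain.2 ⟨hy, hx⟩⟩

theorem mem_graph_smul {x : H →ₗ.[ℂ] H} {c : ℂ} {ξ ζ : H} :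
    (ξ, ζ) ∈ (c • x).graph ↔ ∃ η, (ξ, η) ∈ x.graph ∧ c • η = ζ := by
  constructor
  · intro h
    obtain ⟨⟨ξ', h'⟩, rfl, rfl⟩ := (LinearPMap.mem_graph_iff _).1 h
    exact ⟨_, x.mem_graph ⟨ξ', h'⟩, rfl⟩
  · rintro ⟨η, h1, rfl⟩
    obtain ⟨⟨ξ', hy⟩, rfl, rfl⟩ := (LinearPMap.mem_graph_iff _).1 h1
    exact (c • x).mem_graph ⟨ξ', hy⟩

namespace Preserves

variable {S T : H →L[ℂ] H} {x y : H →ₗ.[ℂ] H}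

theorem add (hS : Preserves S x) (hT : Preserves T x) : Preserves (S + T) x :=
  fun ξ η h => x.graph.add_mem (hS ξ η h) (hT ξ η h)

theorem zero : Preserves 0 x := fun _ _ _ => x.graph.zero_mem

theorem smul (hT : Preserves T x) (c : ℂ) : Preserves (c • T) x :=
  fun ξ η h => x.graph.smul_mem c (hT ξ η h)

theorem comp (hx : Preserves T x) (hy : Preserves T y) : Preserves T (GenArens.comp x y) := by
  intro ξ ζ h
  obtain ⟨η, h1, h2⟩ := mem_graph_comp.1 h
  exact mem_graph_comp.2 ⟨T η, hy _ _ h1, hx _ _ h2⟩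

theorem smul_right (hT : Preserves T x) (c : ℂ) : Preserves T (c • x) := by
  intro ξ ζ h
  obtain ⟨η, h1, rfl⟩ := mem_graph_smul.1 h
  exact mem_graph_smul.2 ⟨T η, hT _ _ h1, (map_smul T c η).symm⟩

theorem of_smul_right {c : ℂ} (hc : c ≠ 0) (hT : Preserves T (c • x)) : Preserves T x := by
  have := hT.smul_right c⁻¹
  rwa [smul_smul, inv_mul_cancel₀ hc, one_smul] at this

end Preserves

theorem isClosed_smul {x : H →ₗ.[ℂ] H} (hx : x.IsClosed) {c : ℂ} (hc : c ≠ 0) :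
    (c • x).IsClosed := by
  have h : ((c • x).graph : Set (H × H)) = (fun p : H × H => (p.1, c⁻¹ • p.2)) ⁻¹' x.graph := by
    ext ⟨ξ, ζ⟩
    rw [SetLike.mem_coe, mem_graph_smul, Set.mem_preimage, SetLike.mem_coe]
    constructor
    · rintro ⟨η, h, rfl⟩
      simpa [smul_smul, inv_mul_cancel₀ hc] using h
    · intro h
      exact ⟨_, h, by simp [smul_smul, mul_inv_cancel₀ hc]⟩
  unfold LinearPMap.IsClosed
  rw [h]
  exact IsClosed.preimage (by fun_prop) hx

/-- A double commutant is norm closed, so `M` is a C*-algebra, and a C*-algebra is the linear span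
of its unitaries. -/
theorem mem_span_unitary (M : VonNeumannAlgebra H) {T : H →L[ℂ] H} (hT : T ∈ M) :
    T ∈ Submodule.span ℂ {u : H →L[ℂ] H | u ∈ unitary (H →L[ℂ] H) ∧ u ∈ M} := by
  have hcl : IsClosed (M.toStarSubalgebra : Set (H →L[ℂ] H)) := by
    rw [VonNeumannAlgebra.coe_toStarSubalgebra, ← M.centralizer_centralizer]
    exact Set.isClosed_centralizer _
  let _ : CStarAlgebra M.toStarSubalgebra := StarSubalgebra.cstarAlgebra _ (h_closed := hcl)
  have h : (⟨T, hT⟩ : M.toStarSubalgebra) ∈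
      Submodule.span ℂ (unitary M.toStarSubalgebra : Set M.toStarSubalgebra) := by
    rw [CStarAlgebra.span_unitary]; trivial
  have h2 := Submodule.mem_map_of_mem (f := M.toStarSubalgebra.subtype.toAlgHom.toLinearMap) h
  rw [Submodule.map_span] at h2
  refine Submodule.span_mono ?_ h2
  rintro _ ⟨u, hu, rfl⟩
  refine ⟨?_, u.2⟩
  have hu' := (Unitary.mem_iff (U := u)).1 hu
  exact Unitary.mem_iff.2 ⟨congrArg Subtype.val hu'.1, congrArg Subtype.val hu'.2⟩

theorem mem_of_commute_unitary {M : VonNeumannAlgebra H} {T : H →L[ℂ] H}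
    (h : ∀ u ∈ unitary (H →L[ℂ] H), u ∈ M.commutant → u * T = T * u) : T ∈ M := by
  rw [← M.commutant_commutant, VonNeumannAlgebra.mem_commutant_iff]
  intro g hg
  replace hg := mem_span_unitary _ hg
  induction hg using Submodule.span_induction with
  | mem u hu => exact h u hu.1 hu.2
  | zero => simp
  | add S S' _ _ h1 h2 => rw [add_mul, mul_add, h1, h2]
  | smul c S _ h1 => rw [smul_mul_assoc, mul_smul_comm, h1]

theorem preserves_of_unitary {M : VonNeumannAlgebra H} {x : H →ₗ.[ℂ] H}
    (h : ∀ u ∈ unitary (H →L[ℂ] H), u ∈ M → Preserves u x) {T : H →L[ℂ] H} (hT : T ∈ M) :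
    Preserves T x := by
  replace hT := mem_span_unitary _ hT
  induction hT using Submodule.span_induction with
  | mem u hu => exact h u hu.1 hu.2
  | zero => exact .zero
  | add S S' _ _ h1 h2 => exact h1.add h2
  | smul c S _ h1 => exact h1.smul c

theorem affiliated_iff {M : VonNeumannAlgebra H} {x : H →ₗ.[ℂ] H} :
    Affiliated M x ↔ ∀ T ∈ M.commutant, Preserves T x := by
  constructor
  · refine fun h T hT => preserves_of_unitary (fun u hu hM ξ η hξ => ?_) hT
    obtain ⟨ξ, rfl, rfl⟩ := (LinearPMap.mem_graph_iff _).1 hξ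
    obtain ⟨h1, h2⟩ := h u hu hM ξ
    simp only [h2]
    exact x.mem_graph ⟨_, h1⟩
  · intro h u _ hM ξ
    have h1 := h u hM _ _ (x.mem_graph ξ)
    obtain ⟨ζ, h2, h3⟩ := (LinearPMap.mem_graph_iff _).1 h1
    have h4 : u (ξ : H) ∈ x.domain := LinearPMap.mem_domain_of_mem_graph h1
    refine ⟨h4, ?_⟩
    exact LinearPMap.mem_graph_snd_inj _ h1 (x.mem_graph ⟨_, h4⟩) rfl

/-- If a bounded operator `e` maps into the domain of a closed operator `x`, then `x e` is
bounded. -/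
theorem exists_mul_of_range_subset {x : H →ₗ.[ℂ] H} (hx : x.IsClosed) {e : H →L[ℂ] H}
    (he : ∀ ξ, e ξ ∈ x.domain) : ∃ c : H →L[ℂ] H, ∀ ξ, (e ξ, c ξ) ∈ x.graph := by
  let g : H →ₗ[ℂ] H := x.toFun ∘ₗ (e : H →ₗ[ℂ] H).codRestrict x.domain he
  have hg : ∀ ξ, (e ξ, g ξ) ∈ x.graph := fun ξ => x.mem_graph ⟨e ξ, he ξ⟩
  refine ⟨ContinuousLinearMap.ofSeqClosedGraph (g := g) ?_, hg⟩
  intro u ξ η hu hgu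
  have h : (e ξ, η) ∈ x.graph :=
    hx.mem_of_tendsto (((e.continuous.tendsto ξ).comp hu).prodMk_nhds hgu)
      (Eventually.of_forall fun n => hg (u n))
  exact LinearPMap.mem_graph_snd_inj _ h (hg ξ) rfl

theorem commute_of_preserves {x : H →ₗ.[ℂ] H} {e c T : H →L[ℂ] H}
    (hc : ∀ ξ, (e ξ, c ξ) ∈ x.graph) (hT : Preserves T x) (he : T * e = e * T) :
    T * c = c * T := by
  ext ξ
  have h1 := hT _ _ (hc ξ)
  have h2 := hc (T ξ)
  exact LinearPMap.mem_graph_snd_inj _ h1 h2 (congrArg (fun S : H →L[ℂ] H => S ξ) he)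

/-! ### Cutoffs and the strong product -/

/-- There are bounded operators `e n` in `N` tending strongly to `1` such that `x (e n)` is
a bounded operator in `N`, and `x (e n)` tends to `x` pointwise on the domain of `x`. -/
def HasCutoff (N : VonNeumannAlgebra H) (x : H →ₗ.[ℂ] H) : Prop :=
  ∃ e c : ℕ → H →L[ℂ] H, (∀ n, e n ∈ N) ∧ (∀ n, c n ∈ N) ∧
    (∀ ξ, Tendsto (fun n => e n ξ) atTop (𝓝 ξ)) ∧ (∀ n ξ, (e n ξ, c n ξ) ∈ x.graph) ∧
    ∀ ξ η, (ξ, η) ∈ x.graph → Tendsto (fun n => c n ξ) atTop (𝓝 η)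

theorem HasCutoff.smul {N : VonNeumannAlgebra H} {x : H →ₗ.[ℂ] H} (h : HasCutoff N x) (z : ℂ) :
    HasCutoff N (z • x) := by
  obtain ⟨e, c, he, hc, h1, h2, h3⟩ := h
  refine ⟨e, fun n => z • c n, he, fun n => N.toStarSubalgebra.smul_mem (hc n) z, h1,
    fun n ξ => mem_graph_smul.2 ⟨_, h2 n ξ, rfl⟩, fun ξ η h => ?_⟩
  obtain ⟨ζ, h4, rfl⟩ := mem_graph_smul.1 h
  exact (h3 _ _ h4).const_smul z

/-- For `η = xξ` and `ζ = yη`, one has `y (e n ξ) = c n ξ` and `x (c n ξ) = c n η`, since `c n`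
commutes with `x`. So `(e n ξ, c n η)` is in the graph of `xy`, and it tends to `(ξ, ζ)`. -/
theorem HasCutoff.graph_comp_le {N : VonNeumannAlgebra H} {x y : H →ₗ.[ℂ] H}
    (hy : HasCutoff N y) (hx : ∀ T ∈ N, Preserves T x) :
    (comp y x).graph ≤ (comp x y).graph.topologicalClosure := by
  obtain ⟨e, c, he, hc, h1, h2, h3⟩ := hy
  rintro ⟨ξ, ζ⟩ h
  obtain ⟨η, h4, h5⟩ := mem_graph_comp.1 h
  exact mem_closure_of_tendsto ((h1 ξ).prodMk_nhds (h3 _ _ h5)) (Eventually.of_forall fun n =>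
    mem_graph_comp.2 ⟨c n ξ, h2 n ξ, hx _ (hc n) _ _ h4⟩)

/-- If `ζ = x(yξ)`, then `e k ζ = c k (yξ) = y (c k ξ)`. This relation involves only bounded
operators and the closed `y`, so it survives on the closure of the graph; at `ξ = 0` it gives `e k ζ
= 0` for all `k`, hence `ζ = 0`. -/
theorem HasCutoff.isClosable_comp {N : VonNeumannAlgebra H} {x y : H →ₗ.[ℂ] H}
    (hx : HasCutoff N x) (hNx : ∀ T ∈ N, Preserves T x) (hNy : ∀ T ∈ N, Preserves T y)
    (hy : y.IsClosed) : (comp x y).IsClosable := by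
  obtain ⟨e, c, he, hc, h1, h2, -⟩ := hx
  have key : ∀ k (p : H × H), p ∈ (comp x y).graph.topologicalClosure →
      (c k p.1, e k p.2) ∈ y.graph := by
    intro k p hp
    have hcont : Continuous fun p : H × H => (c k p.1, e k p.2) := by fun_prop
    have hcl : IsClosed ((fun p : H × H => (c k p.1, e k p.2)) ⁻¹' (y.graph : Set (H × H))) :=
      IsClosed.preimage hcont hy
    refine closure_minimal ?_ hcl hp
    rintro ⟨ξ, ζ⟩ h
    obtain ⟨η, h4, h5⟩ := mem_graph_comp.1 h
    have h6 := LinearPMap.mem_graph_snd_inj _ (hNx _ (he k) _ _ h5) (h2 k η) rfl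
    change (c k ξ, e k ζ) ∈ y.graph
    rw [h6]
    exact hNy _ (hc k) _ _ h4
  refine ⟨(comp x y).graph.topologicalClosure.toLinearPMap,
    (Submodule.toLinearPMap_graph_eq _ ?_).symm⟩
  intro p hp h0
  have h : ∀ k, e k p.2 = 0 := fun k =>
    LinearPMap.graph_fst_eq_zero_snd _ (key k p hp) (by rw [h0, map_zero])
  exact tendsto_nhds_unique (h1 p.2) (by simp only [h]; exact tendsto_const_nhds)

theorem strongMul_comm {N₁ N₂ : VonNeumannAlgebra H} {x y : H →ₗ.[ℂ] H}
    (hx : HasCutoff N₁ x) (hy : HasCutoff N₂ y) (hxx : ∀ T ∈ N₁, Preserves T x)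
    (hxy : ∀ T ∈ N₁, Preserves T y) (hyx : ∀ T ∈ N₂, Preserves T x) (hcl : y.IsClosed) :
    strongMul x y = strongMul y x := by
  have h : (comp x y).graph.topologicalClosure = (comp y x).graph.topologicalClosure :=
    le_antisymm
      (Submodule.topologicalClosure_minimal _ (hx.graph_comp_le hxy)
        (Submodule.isClosed_topologicalClosure _))
      (Submodule.topologicalClosure_minimal _ (hy.graph_comp_le hyx)
        (Submodule.isClosed_topologicalClosure _))
  -- `LinearPMap.closure` leaves a non-closable operator unchanged, so equal graph closures give
  -- equal strong products only once closability is known. One order suffices, as the other has the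
  -- same closed graph.
  have h1 : (comp x y).IsClosable := hx.isClosable_comp hxx hxy hcl
  have h2 : (comp y x).IsClosable := by
    obtain ⟨f, hf⟩ := h1
    exact ⟨f, h ▸ hf⟩
  apply LinearPMap.eq_of_eq_graph
  rw [strongMul, strongMul, ← h1.graph_closure_eq_closure_graph,
    ← h2.graph_closure_eq_closure_graph, h]

/-- A closed operator commuting strongly with a unitary operator is preserved by it. -/
theorem preserves_of_strongMul_eq {x : H →ₗ.[ℂ] H} (hx : x.IsClosed) {u : H →L[ℂ] H}
    (h : strongMul x ((u : H →ₗ[ℂ] H).toPMap ⊤) = strongMul ((u : H →ₗ[ℂ] H).toPMap ⊤) x) :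
    Preserves u x := by
  have hu : ∀ ξ η : H, (ξ, η) ∈ ((u : H →ₗ[ℂ] H).toPMap ⊤).graph ↔ u ξ = η := by
    intro ξ η
    simp [LinearPMap.mem_graph_iff]
  -- The product `xu` is already closed, its graph being a continuous preimage of that of `x`. So
  -- the strong product adds nothing on that side, and `ux ⊆ xu` follows.
  have hg : ((comp x ((u : H →ₗ[ℂ] H).toPMap ⊤)).graph : Set (H × H)) =
      (fun p : H × H => (u p.1, p.2)) ⁻¹' x.graph := by
    ext ⟨ξ, ζ⟩
    simp only [SetLike.mem_coe, mem_graph_comp, hu, exists_eq_left', Set.mem_preimage]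
  have hc : (comp x ((u : H →ₗ[ℂ] H).toPMap ⊤)).IsClosed := by
    unfold LinearPMap.IsClosed
    rw [hg]
    exact IsClosed.preimage (by fun_prop) hx
  intro ξ η hξ
  have h1 : (ξ, u η) ∈ (comp ((u : H →ₗ[ℂ] H).toPMap ⊤) x).graph :=
    mem_graph_comp.2 ⟨η, hξ, (hu _ _).2 rfl⟩
  have h2 := LinearPMap.le_graph_of_le (LinearPMap.le_closure _) h1
  rw [← strongMul, ← h, strongMul, ← hc.isClosable.graph_closure_eq_closure_graph] at h2
  rw [← SetLike.mem_coe, Submodule.topologicalClosure_coe, IsClosed.closure_eq hc, hg] at h2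
  exact h2

/-! ### Projection-valued measures -/

namespace ProjMeasure

variable {M : VonNeumannAlgebra H} (E : ProjMeasure M)

/-- The projection `E(s)` as a bounded operator on `H`. -/
def op (s : Set ℝ≥0) : H →L[ℂ] H := E.proj s

theorem op_mem (s : Set ℝ≥0) : E.op s ∈ M := (E.proj s).2

theorem op_univ : E.op Set.univ = 1 := congrArg Subtype.val E.proj_univ

theorem op_union {s t : Set ℝ≥0} (hs : MeasurableSet s) (ht : MeasurableSet t)
    (hd : Disjoint s t) : E.op (s ∪ t) = E.op s + E.op t := by
  let f : ℕ → Set ℝ≥0 := fun n => if n = 0 then s else if n = 1 then t else ∅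
  have hf : ∀ n, MeasurableSet (f n) := by
    intro n
    simp only [f]
    split_ifs
    exacts [hs, ht, MeasurableSet.empty]
  have hfd : Pairwise (Function.onFun Disjoint f) := by
    intro m n hmn
    simp only [Function.onFun, f]
    split_ifs <;> first | omega | simp [hd.symm]
  have hU : ⋃ n, f n = s ∪ t := by
    ext z
    simp only [Set.mem_iUnion, Set.mem_union, f]
    constructor
    · rintro ⟨n, hn⟩
      split_ifs at hn
      exacts [Or.inl hn, Or.inr hn, hn.elim]
    · rintro (h | h)
      exacts [⟨0, by simpa using h⟩, ⟨1, by simpa using h⟩]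
  ext ξ
  have h1 := E.hasSum f hf hfd ξ
  rw [hU] at h1
  have h2 : HasSum (fun i => (E.proj (f i) : H →L[ℂ] H) ξ)
      (∑ i ∈ ({0, 1} : Finset ℕ), (E.proj (f i) : H →L[ℂ] H) ξ) := by
    refine hasSum_sum_of_ne_finset_zero fun n hn => ?_
    have : f n = ∅ := by
      simp only [Finset.mem_insert, Finset.mem_singleton, not_or] at hn
      simp [f, hn.1, hn.2]
    rw [this, E.proj_empty]
    rfl
  exact (h1.unique h2).trans (by simp [f, op])

theorem op_isStarProjection {s : Set ℝ≥0} (hs : MeasurableSet s) : IsStarProjection (E.op s) :=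
  E.isStarProjection s hs

/-- Idempotency of `P + Q` gives `PQ + QP = 0`. Multiplying by `P` on either side yields `PQ = -PQP
= QP`, so `2PQ = 0`. -/
theorem op_mul_of_disjoint {s t : Set ℝ≥0} (hs : MeasurableSet s) (ht : MeasurableSet t)
    (hd : Disjoint s t) : E.op s * E.op t = 0 := by
  have hP := (E.op_isStarProjection hs).isIdempotentElem.eq
  have hQ := (E.op_isStarProjection ht).isIdempotentElem.eq
  have hPQ := (E.op_isStarProjection (hs.union ht)).isIdempotentElem.eq
  rw [E.op_union hs ht hd] at hPQ
  generalize E.op s = P at *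
  generalize E.op t = Q at *
  have h1 : P * Q + Q * P = 0 := by
    rw [add_mul, mul_add, mul_add, hP, hQ] at hPQ
    refine (add_eq_left (a := P + Q)).1 (Eq.trans ?_ hPQ)
    abel
  have h2 : P * Q + P * Q * P = 0 := by
    have : P * (P * Q + Q * P) = P * P * Q + P * Q * P := by noncomm_ring
    rw [h1, hP, mul_zero] at this
    exact this.symm
  have h3 : P * Q * P + Q * P = 0 := by
    have : (P * Q + Q * P) * P = P * Q * P + Q * (P * P) := by noncomm_ring
    rw [h1, hP, zero_mul] at this
    exact this.symm
  have h4 : P * Q = Q * P := by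
    rw [add_comm] at h3
    exact (eq_neg_of_add_eq_zero_left h2).trans (eq_neg_of_add_eq_zero_left h3).symm
  rw [← h4, ← two_smul ℂ] at h1
  exact (smul_eq_zero_iff_right two_ne_zero).1 h1

theorem op_mul {s t : Set ℝ≥0} (hs : MeasurableSet s) (ht : MeasurableSet t) :
    E.op s * E.op t = E.op (s ∩ t) := by
  have h1 : E.op s = E.op (s ∩ t) + E.op (s \ t) := by
    rw [← E.op_union (hs.inter ht) (hs.diff ht) Set.disjoint_sdiff_inter.symm,
      Set.inter_union_sdiff]
  have h2 : E.op t = E.op (s ∩ t) + E.op (t \ s) := by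
    rw [← E.op_union (hs.inter ht) (ht.diff hs)
      (by rw [Set.inter_comm]; exact Set.disjoint_sdiff_inter.symm),
      Set.inter_comm, Set.inter_union_sdiff]
  rw [h1, h2, add_mul, mul_add, mul_add,
    (E.op_isStarProjection (hs.inter ht)).isIdempotentElem.eq,
    E.op_mul_of_disjoint (hs.inter ht) (ht.diff hs)
      (Set.disjoint_left.2 fun _ h h' => h'.2 h.1),
    E.op_mul_of_disjoint (hs.diff ht) (hs.inter ht)
      (Set.disjoint_left.2 fun _ h h' => h.2 h'.2),
    E.op_mul_of_disjoint (hs.diff ht) (ht.diff hs)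
      (Set.disjoint_left.2 fun _ h h' => h.2 h'.1)]
  simp

theorem op_op {s t : Set ℝ≥0} (hs : MeasurableSet s) (ht : MeasurableSet t) (ξ : H) :
    E.op s (E.op t ξ) = E.op (s ∩ t) ξ := by
  rw [← E.op_mul hs ht]; rfl

theorem op_compl {s : Set ℝ≥0} (hs : MeasurableSet s) : E.op sᶜ = 1 - E.op s := by
  rw [eq_sub_iff_add_eq, ← E.op_univ, ← Set.compl_union_self s,
    E.op_union hs.compl hs disjoint_compl_left]

theorem inner_op_left {s : Set ℝ≥0} (hs : MeasurableSet s) (ξ η : H) :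
    ⟪E.op s ξ, η⟫_ℂ = ⟪ξ, E.op s η⟫_ℂ := by
  have h := (E.op_isStarProjection hs).isSelfAdjoint
  rw [ContinuousLinearMap.isSelfAdjoint_iff'] at h
  rw [← ContinuousLinearMap.adjoint_inner_right, h]

theorem inner_op_self {s : Set ℝ≥0} (hs : MeasurableSet s) (ξ : H) :
    ⟪ξ, E.op s ξ⟫_ℂ = ((‖E.op s ξ‖ ^ 2 : ℝ) : ℂ) := by
  have h : E.op s (E.op s ξ) = E.op s ξ := by rw [E.op_op hs hs, Set.inter_self]
  rw [← h, ← E.inner_op_left hs, h, inner_self_eq_norm_sq_to_K]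
  simp

theorem scalar_eq {s : Set ℝ≥0} (hs : MeasurableSet s) (ξ : H) :
    E.scalar ξ s = ENNReal.ofReal (‖E.op s ξ‖ ^ 2) := by
  rw [E.scalar_apply ξ hs]
  congr 1
  have := congrArg Complex.re (E.inner_op_self hs ξ)
  rwa [Complex.ofReal_re] at this

theorem scalar_univ (ξ : H) : E.scalar ξ Set.univ = ENNReal.ofReal (‖ξ‖ ^ 2) := by
  rw [E.scalar_eq MeasurableSet.univ, E.op_univ]; rfl

instance (ξ : H) : IsFiniteMeasure (E.scalar ξ) :=
  ⟨by rw [E.scalar_univ]; exact ENNReal.ofReal_lt_top⟩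

theorem measureReal_scalar_univ (ξ : H) : (E.scalar ξ).real Set.univ = ‖ξ‖ ^ 2 := by
  rw [measureReal_def, E.scalar_univ, ENNReal.toReal_ofReal (by positivity)]

theorem scalar_op {s : Set ℝ≥0} (hs : MeasurableSet s) (ξ : H) :
    E.scalar (E.op s ξ) = (E.scalar ξ).restrict s := by
  ext t ht
  rw [Measure.restrict_apply ht, E.scalar_eq ht, E.scalar_eq (ht.inter hs), E.op_op ht hs]

theorem op_comm {s t : Set ℝ≥0} (hs : MeasurableSet s) (ht : MeasurableSet t) (ξ : H) :
    E.op s (E.op t ξ) = E.op t (E.op s ξ) := by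
  rw [E.op_op hs ht, E.op_op ht hs, Set.inter_comm]

/-- The scalar measures add up for vectors in the range and in the kernel of `E(s)`. -/
theorem scalar_add {s : Set ℝ≥0} (hs : MeasurableSet s) {ξ₁ ξ₂ : H} (h1 : E.op s ξ₁ = ξ₁)
    (h2 : E.op s ξ₂ = 0) : E.scalar (ξ₁ + ξ₂) = E.scalar ξ₁ + E.scalar ξ₂ := by
  ext t ht
  rw [Measure.add_apply, E.scalar_eq ht, E.scalar_eq ht, E.scalar_eq ht, map_add,
    ← ENNReal.ofReal_add (by positivity) (by positivity)]
  have h0 : ⟪E.op t ξ₁, E.op t ξ₂⟫_ℂ = 0 := by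
    rw [← h1, E.op_comm ht hs, E.inner_op_left hs, E.op_comm hs ht, h2, map_zero, inner_zero_right]
  have h3 := norm_add_sq_eq_norm_sq_add_norm_sq_of_inner_eq_zero (E.op t ξ₁) (E.op t ξ₂) h0
  rw [pow_two, pow_two, pow_two, h3]

theorem op_eq_zero_of_scalar {s : Set ℝ≥0} (hs : MeasurableSet s) {ξ : H}
    (h : E.scalar ξ s = 0) : E.op s ξ = 0 := by
  rw [E.scalar_eq hs, ENNReal.ofReal_eq_zero] at h
  have : ‖E.op s ξ‖ = 0 := by
    have := sq_nonneg ‖E.op s ξ‖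
    exact pow_eq_zero_iff two_ne_zero |>.1 (le_antisymm h this)
  exact norm_eq_zero.1 this

theorem iInter_Ioi_natCast : ⋂ n : ℕ, Set.Ioi (n : ℝ≥0) = ∅ := by
  rw [Set.eq_empty_iff_forall_notMem]
  intro z hz
  obtain ⟨n, hn⟩ := exists_nat_gt z
  exact lt_asymm hn (Set.mem_iInter.1 hz n)

theorem antitone_Ioi_natCast : Antitone fun n : ℕ => Set.Ioi (n : ℝ≥0) :=
  fun _ _ h => Set.Ioi_subset_Ioi (Nat.cast_le.2 h)

/-- The squared error is the scalar measure of `(n, ∞)`, and these sets decrease to the empty set.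
-/
theorem tendsto_op_Iic (ξ : H) : Tendsto (fun n : ℕ => E.op (Set.Iic (n : ℝ≥0)) ξ) atTop (𝓝 ξ) := by
  have h := tendsto_measure_iInter_atTop (μ := E.scalar ξ) (s := fun n : ℕ => Set.Ioi (n : ℝ≥0))
    (fun _ => measurableSet_Ioi.nullMeasurableSet) antitone_Ioi_natCast
    ⟨0, measure_ne_top _ _⟩
  rw [iInter_Ioi_natCast, measure_empty] at h
  have h2 := (ENNReal.tendsto_toReal ENNReal.zero_ne_top).comp h
  have h3 : Tendsto (fun n : ℕ => ‖E.op (Set.Ioi (n : ℝ≥0)) ξ‖ ^ 2) atTop (𝓝 0) := by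
    refine h2.congr fun n => ?_
    simp only [Function.comp_apply]
    rw [E.scalar_eq measurableSet_Ioi, ENNReal.toReal_ofReal (by positivity)]
  have h4 : Tendsto (fun n : ℕ => ‖E.op (Set.Ioi (n : ℝ≥0)) ξ‖) atTop (𝓝 0) := by
    have := h3.sqrt
    simpa using this
  rw [tendsto_iff_norm_sub_tendsto_zero]
  refine h4.congr fun n => ?_
  rw [← Set.compl_Iic, E.op_compl measurableSet_Iic, norm_sub_rev]
  rfl

theorem tendsto_trace_one_sub_op_Iic (τ : FaithfulNormalFiniteTrace M) :
    Tendsto (fun n : ℕ => (τ.toLinearMap (1 - E.proj (Set.Iic (n : ℝ≥0)))).re) atTop (𝓝 0) := by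
  have hfin : E.traceMeasure τ (Set.Ioi ((0 : ℕ) : ℝ≥0)) ≠ ∞ := by
    rw [E.traceMeasure_apply τ measurableSet_Ioi]; exact ENNReal.ofReal_ne_top
  have h := tendsto_measure_iInter_atTop (μ := E.traceMeasure τ)
    (s := fun n : ℕ => Set.Ioi (n : ℝ≥0))
    (fun _ => measurableSet_Ioi.nullMeasurableSet) antitone_Ioi_natCast ⟨0, hfin⟩
  rw [iInter_Ioi_natCast, measure_empty] at h
  refine ((ENNReal.tendsto_toReal ENNReal.zero_ne_top).comp h).congr fun n => ?_
  have h1 : E.proj (Set.Ioi (n : ℝ≥0)) = 1 - E.proj (Set.Iic (n : ℝ≥0)) := by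
    rw [← Set.compl_Iic]
    exact Subtype.ext (E.op_compl measurableSet_Iic)
  simp only [Function.comp_apply]
  rw [E.traceMeasure_apply τ measurableSet_Ioi,
    ENNReal.toReal_ofReal (τ.re_nonneg _ (E.proj_nonneg measurableSet_Ioi)), h1]

/-- If `E([0, α])` commutes with `u` for all `α`, then so does every `E(s)`. -/
theorem op_mul_comm_of_Iic {u : H →L[ℂ] H}
    (h : ∀ α, u * E.op (Set.Iic α) = E.op (Set.Iic α) * u) {s : Set ℝ≥0} (hs : MeasurableSet s) :
    u * E.op s = E.op s * u := by
  refine MeasurableSpace.induction_on_inter (C := fun s _ => u * E.op s = E.op s * u)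
    (borel_eq_generateFrom_Iic ℝ≥0 ▸ BorelSpace.measurable_eq) isPiSystem_Iic ?_ ?_ ?_ ?_ s hs
  · have : E.op ∅ = 0 := congrArg Subtype.val E.proj_empty
    simp [this]
  · rintro _ ⟨α, rfl⟩
    exact h α
  · intro t ht h1
    rw [E.op_compl ht, mul_sub, sub_mul, h1, mul_one, one_mul]
  · intro f hd hf h1
    ext ξ
    have h2 := (E.hasSum f hf (fun i j hij => hd hij) ξ).mapL u
    have h3 := E.hasSum f hf (fun i j hij => hd hij) (u ξ)
    refine h2.unique (h3.congr_fun fun i => ?_)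
    exact congrArg (fun S : H →L[ℂ] H => S ξ) (h1 i)

end ProjMeasure

/-! ### The spectral measure of a positive self-adjoint operator -/

theorem inner_symm_of_isSelfAdjoint {a : H →ₗ.[ℂ] H} (ha : IsSelfAdjoint a) {ξ η ξ' η' : H}
    (h : (ξ, η) ∈ a.graph) (h' : (ξ', η') ∈ a.graph) : ⟪η, ξ'⟫_ℂ = ⟪ξ, η'⟫_ℂ := by
  obtain ⟨ξ, rfl, rfl⟩ := (LinearPMap.mem_graph_iff _).1 h
  obtain ⟨ξ', rfl, rfl⟩ := (LinearPMap.mem_graph_iff _).1 h'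
  have h1 := LinearPMap.adjoint_isFormalAdjoint ha.dense_domain
  rw [LinearPMap.isSelfAdjoint_def.1 ha] at h1
  exact h1 ξ ξ'

namespace ProjMeasure

variable {M : VonNeumannAlgebra H} {E : ProjMeasure M}

namespace IsSpectralMeasureOf

variable {a : H →ₗ.[ℂ] H}

theorem memLp (hE : E.IsSpectralMeasureOf a) {ξ : H} (hξ : ξ ∈ a.domain) :
    MemLp (fun t : ℝ≥0 => (t : ℝ)) 2 (E.scalar ξ) := by
  refine ⟨by fun_prop, ?_⟩
  rw [eLpNorm_lt_top_iff_lintegral_rpow_enorm_lt_top two_ne_zero ENNReal.ofNat_ne_top]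
  have h := (hE.mem_domain_iff ξ).1 hξ
  convert h using 2
  ext t
  simp

theorem integrable (hE : E.IsSpectralMeasureOf a) {ξ : H} (hξ : ξ ∈ a.domain) :
    Integrable (fun t : ℝ≥0 => (t : ℝ)) (E.scalar ξ) :=
  (hE.memLp hξ).integrable one_le_two

theorem inner_graph (hE : E.IsSpectralMeasureOf a) {ξ η : H} (h : (ξ, η) ∈ a.graph) :
    ⟪ξ, η⟫_ℂ = ((∫ t, (t : ℝ) ∂(E.scalar ξ) : ℝ) : ℂ) := by
  obtain ⟨ξ, rfl, rfl⟩ := (LinearPMap.mem_graph_iff _).1 h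
  exact hE.inner_eq ξ

theorem op_mem_domain (hE : E.IsSpectralMeasureOf a) {s : Set ℝ≥0} (hs : MeasurableSet s)
    {ξ : H} (hξ : ξ ∈ a.domain) : E.op s ξ ∈ a.domain := by
  rw [hE.mem_domain_iff, E.scalar_op hs]
  exact (setLIntegral_le_lintegral _ _).trans_lt ((hE.mem_domain_iff ξ).1 hξ)

theorem op_Iic_mem_domain (hE : E.IsSpectralMeasureOf a) (α : ℝ≥0) (ξ : H) :
    E.op (Set.Iic α) ξ ∈ a.domain := by
  rw [hE.mem_domain_iff, E.scalar_op measurableSet_Iic]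
  calc ∫⁻ t in Set.Iic α, (t : ℝ≥0∞) ^ 2 ∂(E.scalar ξ)
      ≤ ∫⁻ _ in Set.Iic α, (α : ℝ≥0∞) ^ 2 ∂(E.scalar ξ) := by
        refine setLIntegral_mono measurable_const fun t ht => ?_
        gcongr
        exact ht
    _ < ∞ := by
        rw [setLIntegral_const]
        exact ENNReal.mul_lt_top (ENNReal.pow_lt_top ENNReal.coe_lt_top) (measure_lt_top _ _)

/-- The scalar measures of `ξ₁` and `c ξ₂` add, so the cross terms in the quadratic form at `ξ₁ + c
ξ₂` cancel for every scalar `c`. Taking `c = 1` and `c = i` kills the real and imaginary parts. -/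
theorem inner_eq_zero (hE : E.IsSpectralMeasureOf a) (ha : IsSelfAdjoint a) {s : Set ℝ≥0}
    (hs : MeasurableSet s) {ξ₁ η₁ ξ₂ η₂ : H} (h1 : (ξ₁, η₁) ∈ a.graph) (h2 : (ξ₂, η₂) ∈ a.graph)
    (hs1 : E.op s ξ₁ = ξ₁) (hs2 : E.op s ξ₂ = 0) : ⟪ξ₁, η₂⟫_ℂ = 0 := by
  have hd1 := LinearPMap.mem_domain_of_mem_graph h1
  have hd2 := LinearPMap.mem_domain_of_mem_graph h2
  have key : ∀ c : ℂ, c * ⟪ξ₁, η₂⟫_ℂ + (starRingEnd ℂ) (c * ⟪ξ₁, η₂⟫_ℂ) = 0 := by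
    intro c
    have h3 := a.graph.add_mem h1 (a.graph.smul_mem c h2)
    have h4 := hE.inner_graph h3
    have h5 := hE.inner_graph h1
    have h6 := hE.inner_graph (a.graph.smul_mem c h2)
    have hi2 := hE.integrable (a.domain.smul_mem c hd2)
    simp only [Prod.smul_mk] at h4 h6
    rw [E.scalar_add hs hs1 (by rw [map_smul, hs2, smul_zero]),
      integral_add_measure (hE.integrable hd1) hi2, Complex.ofReal_add, ← h5, ← h6,
      inner_add_left, inner_add_right, inner_add_right] at h4
    have h7 : ⟪ξ₁, c • η₂⟫_ℂ + ⟪c • ξ₂, η₁⟫_ℂ = 0 := by linear_combination h4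
    rw [inner_smul_right, inner_smul_left] at h7
    rw [map_mul, inner_conj_symm, inner_symm_of_isSelfAdjoint ha h2 h1]
    exact h7
  have k1 := key 1
  have k2 := key Complex.I
  rw [map_mul] at k1 k2
  rw [Complex.conj_I] at k2
  simp only [map_one, one_mul] at k1
  have h3 : 2 * Complex.I * ⟪ξ₁, η₂⟫_ℂ = 0 := by linear_combination Complex.I * k1 + k2
  simpa using h3

/-- Spectral projections of `a` commute with `a`. -/
theorem preserves_op (hE : E.IsSpectralMeasureOf a) (ha : IsSelfAdjoint a) {s : Set ℝ≥0}
    (hs : MeasurableSet s) : Preserves (E.op s) a := by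
  intro ξ η h
  have hd := LinearPMap.mem_domain_of_mem_graph h
  obtain ⟨η₁, h1⟩ := LinearPMap.mem_domain_iff.1 (hE.op_mem_domain hs hd)
  have h2 : (E.op sᶜ ξ, η - η₁) ∈ a.graph := by
    have := a.graph.sub_mem h h1
    rwa [E.op_compl hs]
  have hss : ∀ ζ, E.op s (E.op s ζ) = E.op s ζ := fun ζ => by rw [E.op_op hs hs, Set.inter_self]
  have hcc : ∀ ζ, E.op sᶜ (E.op sᶜ ζ) = E.op sᶜ ζ := fun ζ => by
    rw [E.op_op hs.compl hs.compl, Set.inter_self]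
  have h0 : E.op ∅ = 0 := congrArg Subtype.val E.proj_empty
  have hsc : ∀ ζ, E.op s (E.op sᶜ ζ) = 0 := fun ζ => by
    rw [E.op_op hs hs.compl, Set.inter_compl_self, h0]; rfl
  have hcs : ∀ ζ, E.op sᶜ (E.op s ζ) = 0 := fun ζ => by
    rw [E.op_op hs.compl hs, Set.compl_inter_self, h0]; rfl
  have hdense := ha.dense_domain
  -- Split `ξ` into its components in the range and kernel of `E(s)`. By `inner_eq_zero`, tested on
  -- the dense domain, `a` keeps each component in its own subspace.
  have k1 : E.op s (η - η₁) = 0 := by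
    refine hdense.eq_zero_of_inner_right ℂ fun ζ hζ => ?_
    obtain ⟨θ, hθ⟩ := LinearPMap.mem_domain_iff.1 (hE.op_mem_domain hs hζ)
    rw [← E.inner_op_left hs]
    exact hE.inner_eq_zero ha hs hθ h2 (hss _) (hsc _)
  have k2 : E.op sᶜ η₁ = 0 := by
    refine hdense.eq_zero_of_inner_right ℂ fun ζ hζ => ?_
    obtain ⟨θ, hθ⟩ := LinearPMap.mem_domain_iff.1 (hE.op_mem_domain hs.compl hζ)
    rw [← E.inner_op_left hs.compl]
    exact hE.inner_eq_zero ha hs.compl hθ h1 (hcc _) (hcs _)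
  have k3 : E.op s η = η₁ := by
    rw [map_sub, sub_eq_zero] at k1
    rw [E.op_compl hs] at k2
    rw [k1]
    exact (sub_eq_zero.1 k2).symm
  rwa [k3]

theorem integral_le (hE : E.IsSpectralMeasureOf a) {α : ℝ≥0} {ξ : H}
    (h : E.op (Set.Iic α) ξ = ξ) : ∫ t, (t : ℝ) ∂(E.scalar ξ) ≤ α * ‖ξ‖ ^ 2 := by
  have hd : ξ ∈ a.domain := h ▸ hE.op_Iic_mem_domain α ξ
  have hae : ∀ᵐ t : ℝ≥0 ∂(E.scalar ξ), (t : ℝ) ≤ α := by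
    rw [← h, E.scalar_op measurableSet_Iic]
    exact (ae_restrict_mem (measurableSet_Iic (a := α))).mono fun t ht => NNReal.coe_le_coe.2 ht
  calc ∫ t, (t : ℝ) ∂(E.scalar ξ) ≤ ∫ _ : ℝ≥0, (α : ℝ) ∂(E.scalar ξ) :=
        integral_mono_ae (hE.integrable hd) (integrable_const _) hae
    _ = α * ‖ξ‖ ^ 2 := by rw [integral_const, E.measureReal_scalar_univ, smul_eq_mul, mul_comm]

theorem le_integral (hE : E.IsSpectralMeasureOf a) {β : ℝ≥0} {ξ : H} (hd : ξ ∈ a.domain)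
    (h : E.op (Set.Ici β) ξ = ξ) : β * ‖ξ‖ ^ 2 ≤ ∫ t, (t : ℝ) ∂(E.scalar ξ) := by
  have hae : ∀ᵐ t : ℝ≥0 ∂(E.scalar ξ), (β : ℝ) ≤ t := by
    rw [← h, E.scalar_op measurableSet_Ici]
    exact (ae_restrict_mem (measurableSet_Ici (a := β))).mono fun t ht => NNReal.coe_le_coe.2 ht
  calc β * ‖ξ‖ ^ 2 = ∫ _ : ℝ≥0, (β : ℝ) ∂(E.scalar ξ) := by
        rw [integral_const, E.measureReal_scalar_univ, smul_eq_mul, mul_comm]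
    _ ≤ _ := integral_mono_ae (integrable_const _) (hE.integrable hd) hae

theorem re_inner_graph (hE : E.IsSpectralMeasureOf a) {ξ η : H} (h : (ξ, η) ∈ a.graph) :
    (⟪ξ, η⟫_ℂ).re = ∫ t, (t : ℝ) ∂(E.scalar ξ) := by
  rw [hE.inner_graph h, Complex.ofReal_re]

theorem re_inner_nonneg (hE : E.IsSpectralMeasureOf a) {ξ η : H} (h : (ξ, η) ∈ a.graph) :
    0 ≤ (⟪ξ, η⟫_ℂ).re := by
  rw [hE.re_inner_graph h]
  exact integral_nonneg fun t => t.2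

/-- Positivity of `a` at `αξ - η`, with `⟨η, aη⟩ ≤ α‖η‖²`, gives `α‖η‖² ≤ α²⟨ξ, η⟩`. Cancelling `α >
0` and applying Cauchy–Schwarz finishes. -/
theorem norm_le (hE : E.IsSpectralMeasureOf a) (ha : IsSelfAdjoint a) {α : ℝ≥0} (hα : 0 < α)
    {ξ η : H} (hξ : (ξ, η) ∈ a.graph) (h : E.op (Set.Iic α) ξ = ξ) : ‖η‖ ≤ α * ‖ξ‖ := by
  have hη : E.op (Set.Iic α) η = η := by
    have := hE.preserves_op ha (measurableSet_Iic (a := α)) _ _ hξ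
    rw [h] at this
    exact LinearPMap.mem_graph_snd_inj _ this hξ rfl
  obtain ⟨ζ, hζ⟩ := LinearPMap.mem_domain_iff.1 (hη ▸ hE.op_Iic_mem_domain α η)
  have h1 : (⟪ξ, η⟫_ℂ).re ≤ α * ‖ξ‖ ^ 2 := by
    rw [hE.re_inner_graph hξ]; exact hE.integral_le h
  have h2 : (⟪η, ζ⟫_ℂ).re ≤ α * ‖η‖ ^ 2 := by
    rw [hE.re_inner_graph hζ]; exact hE.integral_le hη
  have h3 := hE.re_inner_nonneg (a.graph.sub_mem (a.graph.smul_mem (α : ℂ) hξ) hζ)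
  have h4 := inner_symm_of_isSelfAdjoint ha hξ hζ
  have h5 : (⟪η, η⟫_ℂ).re = ‖η‖ ^ 2 := by
    rw [inner_self_eq_norm_sq_to_K]; norm_cast
  simp only [Prod.smul_mk, inner_sub_left, inner_sub_right, inner_smul_left,
    inner_smul_right, ← h4, Complex.conj_ofReal, Complex.sub_re, Complex.re_ofReal_mul, h5] at h3
  have hα' : (0 : ℝ) < α := hα
  have h6 : α * ‖η‖ ^ 2 ≤ α * (α * (⟪ξ, η⟫_ℂ).re) := by linarith
  have h7 := le_of_mul_le_mul_left h6 hα'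
  have h8 : ‖η‖ ^ 2 ≤ (α * ‖ξ‖) ^ 2 := by nlinarith
  exact le_of_sq_le_sq h8 (by positivity)

theorem le_norm (hE : E.IsSpectralMeasureOf a) {β : ℝ≥0} {ξ η : H}
    (hξ : (ξ, η) ∈ a.graph) (h : E.op (Set.Ici β) ξ = ξ) : β * ‖ξ‖ ≤ ‖η‖ := by
  have h1 := hE.le_integral (LinearPMap.mem_domain_of_mem_graph hξ) h
  rw [← hE.re_inner_graph hξ] at h1
  have h2 : (⟪ξ, η⟫_ℂ).re ≤ ‖ξ‖ * ‖η‖ := (Complex.re_le_norm _).trans (norm_inner_le_norm _ _)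
  rcases (norm_nonneg ξ).eq_or_lt with h0 | h0
  · rw [← h0, mul_zero]; exact norm_nonneg _
  · refine le_of_mul_le_mul_left ?_ h0
    nlinarith

theorem op_Iic_mem_domain_comp (hE : E.IsSpectralMeasureOf a) (ha : IsSelfAdjoint a) (α : ℝ≥0)
    (ξ : H) : E.op (Set.Iic α) ξ ∈ (comp a a).domain := by
  obtain ⟨η, h⟩ := LinearPMap.mem_domain_iff.1 (hE.op_Iic_mem_domain α ξ)
  have h1 := hE.preserves_op ha (measurableSet_Iic (a := α)) _ _ h
  rw [E.op_op measurableSet_Iic measurableSet_Iic, Set.inter_self] at h1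
  obtain ⟨ζ, h2⟩ := LinearPMap.mem_domain_iff.1 (hE.op_Iic_mem_domain α η)
  exact LinearPMap.mem_domain_iff.2 ⟨ζ, mem_graph_comp.2 ⟨_, h1, h2⟩⟩

/-- The compression `T` intertwines `a²` on the range of `E([0, α])`, where it has norm at most
`α²`, with `a²` on that of `E([β, ∞))`, where it is bounded below by `β²`. Hence `β²‖T‖ ≤ α²‖T‖`,
which forces `T = 0`. -/
theorem op_mul_mul_op_eq_zero (hE : E.IsSpectralMeasureOf a) (ha : IsSelfAdjoint a)
    {u : H →L[ℂ] H} (hu : Preserves u (comp a a)) {α β : ℝ≥0} (h : α < β) :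
    E.op (Set.Ici β) * u * E.op (Set.Iic α) = 0 := by
  -- `norm_le` needs a positive bound; for `α = 0` a larger `γ < β` serves.
  wlog hα : 0 < α generalizing α
  · obtain ⟨γ, h1, h2⟩ := exists_between h
    have h3 := this h2 (pos_of_gt h1)
    have h4 : E.op (Set.Iic α) = E.op (Set.Iic γ) * E.op (Set.Iic α) := by
      rw [E.op_mul measurableSet_Iic measurableSet_Iic, Set.Iic_inter_Iic, min_eq_right h1.le]
    rw [h4, ← mul_assoc, h3, zero_mul]
  set T := E.op (Set.Ici β) * u * E.op (Set.Iic α) with hT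
  have hpres : ∀ {s : Set ℝ≥0}, MeasurableSet s → Preserves (E.op s) (comp a a) :=
    fun hs => (hE.preserves_op ha hs).comp (hE.preserves_op ha hs)
  have hidem : ∀ {s : Set ℝ≥0} (_ : MeasurableSet s) (ξ : H), E.op s (E.op s ξ) = E.op s ξ :=
    fun hs ξ => by rw [E.op_op hs hs, Set.inter_self]
  have key : ∀ ξ, β ^ 2 * ‖T ξ‖ ≤ ‖T‖ * α ^ 2 * ‖ξ‖ := by
    intro ξ
    obtain ⟨ζ, hζ⟩ := LinearPMap.mem_domain_iff.1 (hE.op_Iic_mem_domain_comp ha α ξ)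
    have hζ' : E.op (Set.Iic α) ζ = ζ := by
      have := hpres (measurableSet_Iic (a := α)) _ _ hζ
      rw [hidem measurableSet_Iic] at this
      exact LinearPMap.mem_graph_snd_inj _ this hζ rfl
    have h1 : ‖ζ‖ ≤ α ^ 2 * ‖ξ‖ := by
      obtain ⟨η, h2, h3⟩ := mem_graph_comp.1 hζ
      have hη : E.op (Set.Iic α) η = η := by
        have := hE.preserves_op ha (measurableSet_Iic (a := α)) _ _ h2
        rw [hidem measurableSet_Iic] at this
        exact LinearPMap.mem_graph_snd_inj _ this h2 rfl
      have h4 := hE.norm_le ha hα h2 (hidem measurableSet_Iic _)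
      have h5 := hE.norm_le ha hα h3 hη
      have h6 : ‖E.op (Set.Iic α) ξ‖ ≤ ‖ξ‖ :=
        ((E.op (Set.Iic α)).le_of_opNorm_le
          (E.op_isStarProjection measurableSet_Iic).norm_le ξ).trans_eq (one_mul _)
      calc ‖ζ‖ ≤ α * ‖η‖ := h5
        _ ≤ α * (α * ‖ξ‖) := by gcongr; exact h4.trans (by gcongr)
        _ = α ^ 2 * ‖ξ‖ := by ring
    have hT1 : (T ξ, T ζ) ∈ (comp a a).graph := by
      have := hpres (measurableSet_Ici (a := β)) _ _ (hu _ _ hζ)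
      have h3 : T ζ = E.op (Set.Ici β) (u (E.op (Set.Iic α) ζ)) := rfl
      rw [h3, hζ']
      exact this
    have h2 : β ^ 2 * ‖T ξ‖ ≤ ‖T ζ‖ := by
      obtain ⟨η, h2, h3⟩ := mem_graph_comp.1 hT1
      have hTξ : E.op (Set.Ici β) (T ξ) = T ξ := hidem measurableSet_Ici _
      have hη : E.op (Set.Ici β) η = η := by
        have := hE.preserves_op ha (measurableSet_Ici (a := β)) _ _ h2
        rw [hTξ] at this
        exact LinearPMap.mem_graph_snd_inj _ this h2 rfl
      have h4 := hE.le_norm h2 hTξ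
      have h5 := hE.le_norm h3 hη
      calc (β : ℝ) ^ 2 * ‖T ξ‖ = β * (β * ‖T ξ‖) := by ring
        _ ≤ β * ‖η‖ := by gcongr
        _ ≤ ‖T ζ‖ := h5
    calc (β : ℝ) ^ 2 * ‖T ξ‖ ≤ ‖T‖ * ‖ζ‖ := h2.trans (T.le_opNorm ζ)
      _ ≤ ‖T‖ * (α ^ 2 * ‖ξ‖) := by gcongr
      _ = ‖T‖ * α ^ 2 * ‖ξ‖ := by ring
  have hβ : (0 : ℝ) < β := hα.trans h
  have hn : ‖T‖ ≤ ‖T‖ * α ^ 2 / β ^ 2 := by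
    refine T.opNorm_le_bound (by positivity) fun ξ => ?_
    rw [div_mul_eq_mul_div, le_div_iff₀ (by positivity), mul_comm]
    exact key ξ
  rw [le_div_iff₀ (by positivity)] at hn
  have hlt : (α : ℝ) ^ 2 < β ^ 2 := by
    have : (α : ℝ) < β := h
    gcongr
  have : ‖T‖ = 0 := by nlinarith [norm_nonneg T]
  exact norm_eq_zero.1 this

/-- The gap between `α` and `β` closes by covering `(α, ∞)` with countably many `[v n, ∞)`, each
null for the scalar measure. -/
theorem op_Ioi_mul_mul_op_Iic (hE : E.IsSpectralMeasureOf a) (ha : IsSelfAdjoint a)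
    {u : H →L[ℂ] H} (hu : Preserves u (comp a a)) (α : ℝ≥0) :
    E.op (Set.Ioi α) * u * E.op (Set.Iic α) = 0 := by
  ext ξ
  refine E.op_eq_zero_of_scalar measurableSet_Ioi ?_
  obtain ⟨v, -, hv, hlim⟩ := exists_seq_strictAnti_tendsto α
  have hU : Set.Ioi α ⊆ ⋃ n, Set.Ici (v n) := by
    intro t ht
    obtain ⟨n, hn⟩ := (hlim.eventually_lt_const ht).exists
    exact Set.mem_iUnion.2 ⟨n, hn.le⟩
  refine measure_mono_null hU (measure_iUnion_null fun n => ?_)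
  rw [E.scalar_eq measurableSet_Ici]
  have := congrArg (fun S : H →L[ℂ] H => S ξ) (hE.op_mul_mul_op_eq_zero ha hu (hv n))
  have h1 : E.op (Set.Ici (v n)) (u (E.op (Set.Iic α) ξ)) = 0 := this
  change ENNReal.ofReal (‖E.op (Set.Ici (v n)) (u (E.op (Set.Iic α) ξ))‖ ^ 2) = 0
  rw [h1]
  simp

/-- If `u` and `u*` commute with `a²`, then `u` commutes with the spectral projections of `a`. -/
theorem op_mul_comm (hE : E.IsSpectralMeasureOf a) (ha : IsSelfAdjoint a)
    {u : H →L[ℂ] H} (hu : Preserves u (comp a a)) (hu' : Preserves (star u) (comp a a))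
    {s : Set ℝ≥0} (hs : MeasurableSet s) : u * E.op s = E.op s * u := by
  refine E.op_mul_comm_of_Iic (fun α => ?_) hs
  have h1 := hE.op_Ioi_mul_mul_op_Iic ha hu α
  -- The adjoint of the relation for `u*` supplies the other off-diagonal corner of `u`.
  have h2 := congrArg star (hE.op_Ioi_mul_mul_op_Iic ha hu' α)
  have hsa := (E.op_isStarProjection (measurableSet_Iic (a := α))).isSelfAdjoint.star_eq
  rw [← Set.compl_Iic, E.op_compl measurableSet_Iic] at h1 h2
  simp only [star_mul, star_star, star_sub, star_one, star_zero, hsa] at h2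
  have h3 : u * E.op (Set.Iic α) = E.op (Set.Iic α) * u * E.op (Set.Iic α) := by
    rw [sub_mul, sub_mul, one_mul, sub_eq_zero] at h1
    exact h1
  have h4 : E.op (Set.Iic α) * u = E.op (Set.Iic α) * u * E.op (Set.Iic α) := by
    rw [mul_sub, mul_sub, mul_one, sub_eq_zero, ← mul_assoc] at h2
    exact h2
  rw [h3, ← h4]

end IsSpectralMeasureOf

end ProjMeasure

/-! ### Operators with a spectrally resolved absolute value -/

theorem mem_adjoint_graph_iff {x : H →ₗ.[ℂ] H} (hx : Dense (x.domain : Set H)) {ξ ζ : H} :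
    (ξ, ζ) ∈ x.adjoint.graph ↔ ∀ α β : H, (α, β) ∈ x.graph → ⟪ζ, α⟫_ℂ = ⟪ξ, β⟫_ℂ := by
  constructor
  · intro h α β hαβ
    obtain ⟨ξ, rfl, rfl⟩ := (LinearPMap.mem_graph_iff _).1 h
    obtain ⟨α, rfl, rfl⟩ := (LinearPMap.mem_graph_iff _).1 hαβ
    exact LinearPMap.adjoint_isFormalAdjoint hx ξ α
  · intro h
    have h1 : ∀ α : x.domain, ⟪ζ, (α : H)⟫_ℂ = ⟪ξ, x α⟫_ℂ := fun α => h _ _ (x.mem_graph α)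
    have h2 := LinearPMap.mem_adjoint_domain_of_exists (T := x) ξ ⟨ζ, h1⟩
    have h3 := LinearPMap.adjoint_apply_eq hx ⟨ξ, h2⟩ h1
    rw [← h3]
    exact x.adjoint.mem_graph ⟨ξ, h2⟩

theorem Preserves.adjoint {x : H →ₗ.[ℂ] H} (hx : Dense (x.domain : Set H)) {T : H →L[ℂ] H}
    (h : Preserves (star T) x) : Preserves T x.adjoint := by
  intro ξ ζ hξ
  rw [mem_adjoint_graph_iff hx] at hξ ⊢
  intro α β hαβ
  rw [← ContinuousLinearMap.adjoint_inner_right, ← ContinuousLinearMap.adjoint_inner_right]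
  exact hξ _ _ (h _ _ hαβ)

/-- A bounded sequence of partial sums of an orthogonal series converges. -/
theorem cauchySeq_of_inner_eq {g : ℕ → H} {η : H} (h : ∀ m n, m ≤ n → ⟪g m, g n⟫_ℂ = ⟪g m, g m⟫_ℂ)
    (hη : ∀ m, ⟪g m, η⟫_ℂ = ⟪g m, g m⟫_ℂ) : CauchySeq g := by
  have hself : ∀ m, (⟪g m, g m⟫_ℂ).re = ‖g m‖ ^ 2 := fun m => by
    rw [inner_self_eq_norm_sq_to_K]; norm_cast
  have hsub : ∀ m n, m ≤ n → ‖g n - g m‖ ^ 2 = ‖g n‖ ^ 2 - ‖g m‖ ^ 2 := by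
    intro m n hmn
    have h1 := norm_sub_sq (𝕜 := ℂ) (g m) (g n)
    rw [h m n hmn, RCLike.re_to_complex, hself] at h1
    rw [norm_sub_rev, h1]
    ring
  have hbdd : ∀ m, ‖g m‖ ≤ ‖η‖ := by
    intro m
    have h1 : ‖g m‖ ^ 2 ≤ ‖g m‖ * ‖η‖ := by
      rw [← hself, ← hη]
      exact (Complex.re_le_norm _).trans (norm_inner_le_norm _ _)
    rcases (norm_nonneg (g m)).eq_or_lt with h0 | h0
    · rw [← h0]; exact norm_nonneg _
    · refine le_of_mul_le_mul_left ?_ h0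
      rwa [← pow_two]
  have hmono : Monotone fun n => ‖g n‖ ^ 2 := by
    intro m n hmn
    have := hsub m n hmn
    have := sq_nonneg ‖g n - g m‖
    simp only
    linarith
  have hb : BddAbove (Set.range fun n => ‖g n‖ ^ 2) := by
    refine ⟨‖η‖ ^ 2, ?_⟩
    rintro _ ⟨n, rfl⟩
    exact pow_le_pow_left₀ (norm_nonneg _) (hbdd n) 2
  have hlim := tendsto_atTop_ciSup hmono hb
  rw [Metric.cauchySeq_iff']
  intro ε hε
  obtain ⟨N, hN⟩ := (hlim.eventually_const_lt (sub_lt_self _ (pow_pos hε 2))).exists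
  refine ⟨N, fun n hn => ?_⟩
  rw [dist_eq_norm]
  refine lt_of_pow_lt_pow_left₀ 2 hε.le ?_
  rw [hsub N n hn]
  have := le_ciSup hb n
  linarith

namespace IsAbs

variable {M : VonNeumannAlgebra H} {E : ProjMeasure M} {a x : H →ₗ.[ℂ] H}

theorem op_Iic_mem_domain (h : IsAbs a x) (hE : E.IsSpectralMeasureOf a) (α : ℝ≥0) (ξ : H) :
    E.op (Set.Iic α) ξ ∈ x.domain := by
  have h1 := hE.op_Iic_mem_domain_comp h.isSelfAdjoint α ξ
  rw [h.sq_eq] at h1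
  exact (mem_comp_domain.1 h1).1

theorem dense_domain (h : IsAbs a x) (hE : E.IsSpectralMeasureOf a) :
    Dense (x.domain : Set H) := fun ξ =>
  mem_closure_of_tendsto (E.tendsto_op_Iic ξ)
    (Eventually.of_forall fun n => h.op_Iic_mem_domain hE n ξ)

/-- The domain of `x* x` is a core of `x`. -/
theorem tendsto_of_cutoff (h : IsAbs a x) (hE : E.IsSpectralMeasureOf a) (hx : x.IsClosed)
    {c : ℕ → H →L[ℂ] H} (hc : ∀ (n : ℕ) ξ, (E.op (Set.Iic (n : ℝ≥0)) ξ, c n ξ) ∈ x.graph) {ξ η : H}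
    (hξ : (ξ, η) ∈ x.graph) : Tendsto (fun n => c n ξ) atTop (𝓝 η) := by
  set e : ℕ → H →L[ℂ] H := fun n => E.op (Set.Iic (n : ℝ≥0)) with he
  have hms : ∀ n : ℕ, MeasurableSet (Set.Iic (n : ℝ≥0)) := fun _ => measurableSet_Iic
  have hee : ∀ m n, m ≤ n → e m (e n ξ) = e m ξ := by
    intro m n hmn
    simp only [he]
    rw [E.op_op (hms m) (hms n), Set.Iic_inter_Iic, min_eq_left (Nat.cast_le.2 hmn)]
  -- Here `z n = x* x (e n ξ) = a² (e n ξ)`, which `e n` fixes.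
  have hz : ∀ n, ∃ ζ, (c n ξ, ζ) ∈ x.adjoint.graph ∧ e n ζ = ζ := by
    intro n
    obtain ⟨ζ, hζ⟩ := LinearPMap.mem_domain_iff.1
      (hE.op_Iic_mem_domain_comp h.isSelfAdjoint (n : ℝ≥0) ξ)
    have hp := hE.preserves_op h.isSelfAdjoint (hms n)
    have h1 := hp.comp hp _ _ hζ
    rw [E.op_op (hms n) (hms n), Set.inter_self] at h1
    have h2 := LinearPMap.mem_graph_snd_inj _ h1 hζ rfl
    rw [h.sq_eq] at hζ
    obtain ⟨η', h3, h4⟩ := mem_graph_comp.1 hζ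
    have h5 := LinearPMap.mem_graph_snd_inj _ h3 (hc n ξ) rfl
    exact ⟨ζ, h5 ▸ h4, h2⟩
  choose z hz1 hz2 using hz
  have hd := h.dense_domain hE
  have hself : ∀ m, ⟪c m ξ, c m ξ⟫_ℂ = ⟪z m, e m ξ⟫_ℂ := fun m =>
    ((mem_adjoint_graph_iff hd).1 (hz1 m) _ _ (hc m ξ)).symm
  -- Both inner products equal `⟨z m, e m ξ⟩`: moving `x` across gives `⟨z m, e n ξ⟩`, and `e m`
  -- absorbs `e n`.
  have hmn : ∀ m n, m ≤ n → ⟪c m ξ, c n ξ⟫_ℂ = ⟪c m ξ, c m ξ⟫_ℂ := by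
    intro m n hmn
    rw [hself, ← (mem_adjoint_graph_iff hd).1 (hz1 m) _ _ (hc n ξ), ← hz2 m,
      E.inner_op_left (hms m), E.inner_op_left (hms m)]
    change ⟪z m, e m (e n ξ)⟫_ℂ = ⟪z m, e m (e m ξ)⟫_ℂ
    rw [hee m n hmn, hee m m le_rfl]
  have hη : ∀ m, ⟪c m ξ, η⟫_ℂ = ⟪c m ξ, c m ξ⟫_ℂ := by
    intro m
    rw [hself, ← (mem_adjoint_graph_iff hd).1 (hz1 m) _ _ hξ, ← hz2 m,
      E.inner_op_left (hms m), E.inner_op_left (hms m)]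
    change ⟪z m, e m ξ⟫_ℂ = ⟪z m, e m (e m ξ)⟫_ℂ
    rw [hee m m le_rfl]
  obtain ⟨η', hη'⟩ := cauchySeq_tendsto_of_complete (cauchySeq_of_inner_eq hmn hη)
  have h1 : (ξ, η') ∈ x.graph :=
    hx.mem_of_tendsto ((E.tendsto_op_Iic ξ).prodMk_nhds hη') (Eventually.of_forall fun n => hc n ξ)
  rwa [← LinearPMap.mem_graph_snd_inj _ h1 hξ rfl]

theorem hasCutoff (h : IsAbs a x) (hE : E.IsSpectralMeasureOf a) (hx : x.IsClosed)
    {N : VonNeumannAlgebra H} (hN : ∀ n : ℕ, E.op (Set.Iic (n : ℝ≥0)) ∈ N)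
    (hc : ∀ (n : ℕ) (c : H →L[ℂ] H),
      (∀ ξ, (E.op (Set.Iic (n : ℝ≥0)) ξ, c ξ) ∈ x.graph) → c ∈ N) : HasCutoff N x := by
  choose c hcg using fun n : ℕ => exists_mul_of_range_subset hx (h.op_Iic_mem_domain hE (n : ℝ≥0))
  exact ⟨_, c, hN, fun n => hc n _ (hcg n), E.tendsto_op_Iic, hcg,
    fun ξ η hξ => h.tendsto_of_cutoff hE hx hcg hξ⟩

/-- A bounded operator commuting with `x` together with its adjoint commutes with the spectral
projections of `|x|`. -/
theorem op_mul_comm (h : IsAbs a x) (hE : E.IsSpectralMeasureOf a) {T : H →L[ℂ] H}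
    (hT : Preserves T x) (hT' : Preserves (star T) x) {s : Set ℝ≥0} (hs : MeasurableSet s) :
    T * E.op s = E.op s * T := by
  have hd := h.dense_domain hE
  refine hE.op_mul_comm h.isSelfAdjoint ?_ ?_ hs
  · rw [h.sq_eq]
    exact (hT'.adjoint hd).comp hT
  · rw [h.sq_eq]
    exact (Preserves.adjoint hd (by rwa [star_star])).comp hT'

end IsAbs

theorem mem_of_cutoff {M : VonNeumannAlgebra H} {x : H →ₗ.[ℂ] H}
    (hx : ∀ T ∈ M.commutant, Preserves T x) {e c : H →L[ℂ] H} (he : e ∈ M)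
    (hc : ∀ ξ, (e ξ, c ξ) ∈ x.graph) : c ∈ M := by
  refine mem_of_commute_unitary fun u _ huM => ?_
  exact commute_of_preserves hc (hx u huM) (VonNeumannAlgebra.mem_commutant_iff.1 huM _ he).symm

/-- Commutation with each bounded `c n` passes to the limit `x`. This is how `x` becomes affiliated
with the smaller algebra `Z(M)`. -/
theorem HasCutoff.preserves {N : VonNeumannAlgebra H} {x : H →ₗ.[ℂ] H} (h : HasCutoff N x)
    (hx : x.IsClosed) {T : H →L[ℂ] H} (hT : T ∈ N.commutant) : Preserves T x := by
  obtain ⟨e, c, he, hc, h1, h2, h3⟩ := h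
  rw [VonNeumannAlgebra.mem_commutant_iff] at hT
  intro ξ η hξ
  refine hx.mem_of_tendsto ((h1 (T ξ)).prodMk_nhds ((T.continuous.tendsto η).comp (h3 _ _ hξ)))
    (Eventually.of_forall fun n => ?_)
  have h4 : T (c n ξ) = c n (T ξ) := congrArg (fun S : H →L[ℂ] H => S ξ) (hT _ (hc n)).symm
  simp only [Function.comp_apply, h4]
  exact h2 n (T ξ)

/-! ### Changing the von Neumann algebra -/

namespace ProjMeasure

variable {M N : VonNeumannAlgebra H} (E : ProjMeasure M)

open Classical in
/-- A projection-valued measure of `M` whose projections lie in `N`, as one of `N`. -/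
def ofMem (N : VonNeumannAlgebra H) (h : ∀ s, MeasurableSet s → E.op s ∈ N) : ProjMeasure N where
  -- Membership in `N` is known only for measurable sets; the value `0` elsewhere is never used.
  proj s := if hs : MeasurableSet s then ⟨E.op s, h s hs⟩ else 0
  isStarProjection s hs := by
    rw [dif_pos hs]
    exact E.isStarProjection s hs
  proj_univ := by
    rw [dif_pos MeasurableSet.univ]
    exact Subtype.ext E.op_univ
  hasSum s hs hd ξ := by
    simp only [dif_pos (MeasurableSet.iUnion hs), dif_pos (hs _)]
    exact E.hasSum s hs hd ξ

variable {E} {h : ∀ s, MeasurableSet s → E.op s ∈ N}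

theorem coe_ofMem_proj {s : Set ℝ≥0} (hs : MeasurableSet s) :
    ((E.ofMem N h).proj s : H →L[ℂ] H) = E.proj s := by
  simp only [ofMem, dif_pos hs]
  rfl

theorem scalar_ofMem (ξ : H) : (E.ofMem N h).scalar ξ = E.scalar ξ := by
  ext s hs
  rw [scalar_apply _ _ hs, scalar_apply _ _ hs, coe_ofMem_proj hs]

theorem IsSpectralMeasureOf.ofMem {a : H →ₗ.[ℂ] H} (hE : E.IsSpectralMeasureOf a) :
    (E.ofMem N h).IsSpectralMeasureOf a where
  mem_domain_iff ξ := by rw [scalar_ofMem]; exact hE.mem_domain_iff ξ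
  inner_eq ξ := by rw [scalar_ofMem]; exact hE.inner_eq ξ

/-- The projection-valued measure concentrated at a point. -/
def dirac (M : VonNeumannAlgebra H) (r : ℝ≥0) : ProjMeasure M where
  proj s := s.indicator (fun _ => 1) r
  isStarProjection s _ := by
    by_cases hr : r ∈ s
    · rw [Set.indicator_of_mem hr]; exact IsStarProjection.one _
    · rw [Set.indicator_of_notMem hr]; exact IsStarProjection.zero _
  proj_univ := by simp
  hasSum s _ hd ξ := by
    by_cases hr : r ∈ ⋃ i, s i
    · obtain ⟨i, hi⟩ := Set.mem_iUnion.1 hr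
      rw [Set.indicator_of_mem hr]
      convert hasSum_single (f := fun j => (((s j).indicator
        (fun _ => (1 : M.toStarSubalgebra)) r : M.toStarSubalgebra) : H →L[ℂ] H) ξ) i ?_ using 1
      · simp only [Set.indicator_of_mem hi]
      · intro j hj
        have : r ∉ s j := fun hj' => Set.disjoint_left.1 (hd hj) hj' hi
        simp only [Set.indicator_of_notMem this]
        rfl
    · have h0 : ∀ i, r ∉ s i := fun i hi => hr (Set.mem_iUnion.2 ⟨i, hi⟩)
      simp only [Set.indicator_of_notMem hr, Set.indicator_of_notMem (h0 _)]
      exact hasSum_zero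

theorem scalar_dirac (r : ℝ≥0) (ξ : H) :
    (dirac M r).scalar ξ = ENNReal.ofReal (‖ξ‖ ^ 2) • Measure.dirac r := by
  ext s hs
  rw [scalar_eq _ hs, Measure.smul_apply, Measure.dirac_apply' _ hs, smul_eq_mul]
  by_cases hr : r ∈ s
  · simp [op, dirac, hr]
  · simp [op, dirac, hr]

theorem traceMeasure_dirac (τ : FaithfulNormalFiniteTrace M) (r : ℝ≥0) :
    (dirac M r).traceMeasure τ = ENNReal.ofReal (τ.toLinearMap 1).re • Measure.dirac r := by
  ext s hs
  rw [traceMeasure_apply _ _ hs, Measure.smul_apply, Measure.dirac_apply' _ hs, smul_eq_mul]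
  by_cases hr : r ∈ s
  · simp [dirac, hr]
  · simp [dirac, hr]

end ProjMeasure

/-! ### Orlicz balls over `M` and over its center -/

theorem orliczBall_center_subset (M : VonNeumannAlgebra H) (τ : FaithfulNormalFiniteTrace M)
    (φ : ℝ≥0 → ℝ≥0) :
    orliczBall (center M) (τ.restrict (center M) (center_le M)) φ ⊆ orliczBall M τ φ := by
  rintro x ⟨⟨hcl, haff, hdense⟩, a, E, ha, hE, hint⟩
  have hmem : ∀ s, MeasurableSet s → E.op s ∈ M := fun s _ => (E.op_mem s).1
  refine ⟨⟨hcl, ?_, fun ε hε => ?_⟩, a, E.ofMem M hmem, ha, hE.ofMem, ?_⟩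
  · rw [affiliated_iff] at haff ⊢
    refine fun T hT => haff T ?_
    rw [VonNeumannAlgebra.mem_commutant_iff] at hT ⊢
    exact fun g hg => hT g hg.1
  · obtain ⟨p, hp, hpx, hpε⟩ := hdense ε hε
    exact ⟨StarSubalgebra.inclusion (center_le M) p, hp, hpx, hpε⟩
  · refine le_of_eq_of_le ?_ hint
    congr 1
    ext s hs
    rw [ProjMeasure.traceMeasure_apply _ _ hs, ProjMeasure.traceMeasure_apply _ _ hs]
    have : (E.ofMem M hmem).proj s = StarSubalgebra.inclusion (center_le M) (E.proj s) :=
      Subtype.ext (ProjMeasure.coe_ofMem_proj hs)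
    rw [this]
    rfl

/-- The spectral projections of `|x|` commute with `M`, so they and the cutoffs of `x` lie in
`Z(M)`. Finiteness of the trace makes `E([0, n])` a witness for `τ`-density. -/
theorem mem_orliczBall_center {M : VonNeumannAlgebra H} {τ : FaithfulNormalFiniteTrace M}
    {φ : ℝ≥0 → ℝ≥0} {x : H →ₗ.[ℂ] H} (hx : x ∈ orliczBall M τ φ)
    (hM : ∀ T ∈ M, Preserves T x) :
    x ∈ orliczBall (center M) (τ.restrict (center M) (center_le M)) φ := by
  obtain ⟨⟨hcl, haff, -⟩, a, E, ha, hE, hint⟩ := hx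
  rw [affiliated_iff] at haff
  have hmem : ∀ s, MeasurableSet s → E.op s ∈ center M := by
    refine fun s hs => mem_center_iff.2 ⟨E.op_mem s, ?_⟩
    rw [VonNeumannAlgebra.mem_commutant_iff]
    exact fun g hg => ha.op_mul_comm hE (hM g hg) (hM _ (star_mem hg)) hs
  have hcut : HasCutoff (center M) x := by
    refine ha.hasCutoff hE hcl (fun n => hmem _ measurableSet_Iic) fun n c hc => ?_
    have he := hmem _ (measurableSet_Iic (a := (n : ℝ≥0)))
    refine mem_center_iff.2 ⟨mem_of_cutoff haff he.1 hc, mem_of_cutoff ?_ he.2 hc⟩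
    rwa [M.commutant_commutant]
  have hproj : ∀ s, MeasurableSet s →
      StarSubalgebra.inclusion (center_le M) ((E.ofMem _ hmem).proj s) = E.proj s :=
    fun s hs => Subtype.ext (ProjMeasure.coe_ofMem_proj (E := E) (h := hmem) hs)
  refine ⟨⟨hcl, affiliated_iff.2 fun T hT => hcut.preserves hcl hT, fun ε hε => ?_⟩,
    a, E.ofMem _ hmem, ha, hE.ofMem, ?_⟩
  · obtain ⟨n, hn⟩ := ((E.tendsto_trace_one_sub_op_Iic τ).eventually_lt_const hε).exists
    refine ⟨(E.ofMem _ hmem).proj (Set.Iic (n : ℝ≥0)),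
      (E.ofMem _ hmem).isStarProjection _ measurableSet_Iic, fun ξ => ?_, ?_⟩
    · rw [ProjMeasure.coe_ofMem_proj measurableSet_Iic]
      exact ha.op_Iic_mem_domain hE n ξ
    · rw [← hproj _ measurableSet_Iic] at hn
      exact hn
  · refine le_of_eq_of_le ?_ hint
    congr 1
    ext s hs
    rw [ProjMeasure.traceMeasure_apply _ _ hs, ProjMeasure.traceMeasure_apply _ _ hs,
      ← hproj s hs]
    rfl

/-- Elements of an Orlicz space are closed, affiliated, and have cutoffs in the algebra. -/
theorem orliczSpace_spec {M : VonNeumannAlgebra H} {τ : FaithfulNormalFiniteTrace M}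
    {φ : ℝ≥0 → ℝ≥0} {x : H →ₗ.[ℂ] H} (hx : x ∈ orliczSpace M τ φ) :
    x.IsClosed ∧ (∀ T ∈ M.commutant, Preserves T x) ∧ HasCutoff M x := by
  simp only [orliczSpace, Set.mem_iUnion] at hx
  obtain ⟨n, hn, x, ⟨⟨hcl, haff, -⟩, a, E, ha, hE, -⟩, rfl⟩ := hx
  rw [affiliated_iff] at haff
  have hn0 : (n : ℂ) ≠ 0 := Nat.cast_ne_zero.2 (by omega)
  refine ⟨isClosed_smul hcl hn0, fun T hT => (haff T hT).smul_right _,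
    HasCutoff.smul (ha.hasCutoff hE hcl (fun n => E.op_mem _) fun n c hc => ?_) _⟩
  exact mem_of_cutoff haff (E.op_mem _) hc

/-! ### Unitary operators belong to every Orlicz space -/

theorem mem_graph_toPMap_top {T : H →L[ℂ] H} {ξ η : H} :
    (ξ, η) ∈ ((T : H →ₗ[ℂ] H).toPMap ⊤).graph ↔ T ξ = η := by
  simp [LinearPMap.mem_graph_iff]

theorem smul_toPMap_top (c : ℂ) (T : H →L[ℂ] H) :
    ((c • T : H →L[ℂ] H) : H →ₗ[ℂ] H).toPMap ⊤ = c • (T : H →ₗ[ℂ] H).toPMap ⊤ := by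
  apply LinearPMap.eq_of_eq_graph
  ext ⟨ξ, η⟩
  simp only [mem_graph_toPMap_top, mem_graph_smul, exists_eq_left']
  rfl

theorem adjoint_toPMap_top (T : H →L[ℂ] H) :
    ((T : H →ₗ[ℂ] H).toPMap ⊤).adjoint = ((star T : H →L[ℂ] H) : H →ₗ[ℂ] H).toPMap ⊤ :=
  ContinuousLinearMap.toPMap_adjoint_eq_adjoint_toPMap_of_dense T (by simp)

theorem isClosed_toPMap_top (T : H →L[ℂ] H) : ((T : H →ₗ[ℂ] H).toPMap ⊤).IsClosed := by
  have h : (((T : H →ₗ[ℂ] H).toPMap ⊤).graph : Set (H × H)) = {p | T p.1 = p.2} := by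
    ext ⟨ξ, η⟩
    exact mem_graph_toPMap_top
  unfold LinearPMap.IsClosed
  rw [h]
  exact isClosed_eq (by fun_prop) (by fun_prop)

/-- Since `u* u = 1`, the absolute value of `r u` is `r · 1`, with spectral measure concentrated at
`r`; the integral is `τ(1) φ(r)`. -/
theorem smul_unitary_mem_orliczBall {M : VonNeumannAlgebra H} {τ : FaithfulNormalFiniteTrace M}
    {φ : ℝ≥0 → ℝ≥0} {u : H →L[ℂ] H} (hu : u ∈ unitary (H →L[ℂ] H)) (huM : u ∈ M) {r : ℝ≥0}
    (hr : ENNReal.ofReal (τ.toLinearMap 1).re * φ r ≤ 1) :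
    (((r : ℂ) • u : H →L[ℂ] H) : H →ₗ[ℂ] H).toPMap ⊤ ∈ orliczBall M τ φ := by
  refine ⟨⟨isClosed_toPMap_top _, ?_, fun ε hε => ⟨1, IsStarProjection.one _, ?_, ?_⟩⟩,
    (((r : ℂ) • (1 : H →L[ℂ] H) : H →L[ℂ] H) : H →ₗ[ℂ] H).toPMap ⊤, ProjMeasure.dirac M r,
    ⟨?_, ?_, ?_⟩, ⟨?_, ?_⟩, ?_⟩
  · rw [affiliated_iff]
    intro T hT ξ η h
    rw [mem_graph_toPMap_top] at h ⊢
    have h1 : u (T ξ) = T (u ξ) :=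
      congrArg (fun S : H →L[ℂ] H => S ξ) (VonNeumannAlgebra.mem_commutant_iff.1 hT u huM)
    rw [← h]
    simp [h1]
  · exact fun _ => Submodule.mem_top
  · simpa using hε
  · rw [LinearPMap.isSelfAdjoint_def, adjoint_toPMap_top]
    simp
  · intro ξ
    change 0 ≤ (⟪(ξ : H), ((r : ℝ) : ℂ) • (ξ : H)⟫_ℂ).re
    rw [inner_smul_right, Complex.re_ofReal_mul]
    exact mul_nonneg r.2 (inner_self_nonneg (𝕜 := ℂ))
  · have hu1 : star u * u = 1 := (Unitary.mem_iff.1 hu).1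
    rw [adjoint_toPMap_top]
    apply LinearPMap.eq_of_eq_graph
    ext ⟨ξ, η⟩
    have h1 : star u (u ξ) = ξ := congrArg (fun S : H →L[ℂ] H => S ξ) hu1
    simp only [mem_graph_comp, mem_graph_toPMap_top, exists_eq_left']
    simp [h1]
  · intro ξ
    rw [ProjMeasure.scalar_dirac, lintegral_smul_measure, lintegral_dirac, smul_eq_mul]
    exact ⟨fun _ => ENNReal.mul_lt_top ENNReal.ofReal_lt_top
      (ENNReal.pow_lt_top ENNReal.coe_lt_top), fun _ => Submodule.mem_top⟩
  · intro ξ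
    rw [ProjMeasure.scalar_dirac, integral_smul_measure, integral_dirac,
      ENNReal.toReal_ofReal (by positivity)]
    change ⟪(ξ : H), (r : ℂ) • (ξ : H)⟫_ℂ = _
    rw [inner_smul_right, inner_self_eq_norm_sq_to_K, smul_eq_mul]
    simp [mul_comm]
  · rwa [ProjMeasure.traceMeasure_dirac, lintegral_smul_measure, lintegral_dirac, smul_eq_mul]

/-- Monotonicity of the density on `(0, 1]` gives `φ(1/n) ≤ d(1)/n`. -/
theorem IsYoung.tendsto_inv_natCast {φ : ℝ≥0 → ℝ≥0} (hφ : IsYoung φ) :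
    Tendsto (fun n : ℕ => φ (n : ℝ≥0)⁻¹) atTop (𝓝 0) := by
  obtain ⟨d, -, -, -, -, hmono, hφ⟩ := hφ
  rw [← NNReal.tendsto_coe, NNReal.coe_zero]
  have hlim : Tendsto (fun n : ℕ => (d 1 : ℝ) * (n : ℝ)⁻¹) atTop (𝓝 0) := by
    simpa using tendsto_inv_atTop_nhds_zero_nat (𝕜 := ℝ) |>.const_mul (d 1 : ℝ)
  refine squeeze_zero' (Eventually.of_forall fun n => NNReal.coe_nonneg _) ?_ hlim
  filter_upwards [eventually_ge_atTop 1] with n hn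
  have hn' : (n : ℝ)⁻¹ ≤ 1 := inv_le_one_of_one_le₀ (by exact_mod_cast hn)
  rw [hφ]
  have h := intervalIntegral.norm_integral_le_of_norm_le_const (a := (0 : ℝ))
    (b := (((n : ℝ≥0)⁻¹ : ℝ≥0) : ℝ)) (f := fun s => (d s.toNNReal : ℝ)) (C := d 1) ?_
  · refine (Real.le_norm_self _).trans (h.trans_eq ?_)
    rw [sub_zero, abs_of_nonneg (NNReal.coe_nonneg _)]
    simp
  · intro s hs
    rw [Set.uIoc_of_le (NNReal.coe_nonneg _)] at hs
    have hs1 : s ≤ 1 := hs.2.trans (by simpa using hn')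
    rw [Real.norm_of_nonneg (NNReal.coe_nonneg _), NNReal.coe_le_coe]
    refine hmono (Real.toNNReal_pos.2 hs.1) (Set.mem_Ioi.2 one_pos) ?_
    rwa [Real.toNNReal_le_one]

theorem unitary_mem_orliczSpace {M : VonNeumannAlgebra H} {τ : FaithfulNormalFiniteTrace M}
    {φ : ℝ≥0 → ℝ≥0} (hφ : IsYoung φ) {u : H →L[ℂ] H} (hu : u ∈ unitary (H →L[ℂ] H))
    (huM : u ∈ M) : (u : H →ₗ[ℂ] H).toPMap ⊤ ∈ orliczSpace M τ φ := by
  have h1 : Tendsto (fun n : ℕ => ENNReal.ofReal (τ.toLinearMap 1).re * φ (n : ℝ≥0)⁻¹) atTop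
      (𝓝 0) := by
    have := ENNReal.Tendsto.const_mul (a := ENNReal.ofReal (τ.toLinearMap 1).re)
      (ENNReal.tendsto_coe.2 hφ.tendsto_inv_natCast) (Or.inr ENNReal.ofReal_ne_top)
    simpa using this
  -- Write `u = n (n⁻¹ u)` with `n` so large that `τ(1) φ(1/n) ≤ 1`.
  obtain ⟨n, hn, hn1⟩ := ((h1.eventually_le_const one_pos).and (eventually_ge_atTop 1)).exists
  simp only [orliczSpace, Set.mem_iUnion]
  refine ⟨n, hn1, _, smul_unitary_mem_orliczBall hu huM hn, ?_⟩
  have hn0 : (n : ℂ) ≠ 0 := Nat.cast_ne_zero.2 (by omega)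
  change (n : ℂ) • _ = _
  rw [← smul_toPMap_top, smul_smul]
  congr 2
  simp [hn0]

end GenArens

end

/-- For a von Neumann algebra `M` with a faithful normal finite trace `τ` and a quadratic family
`Λ` of Young functions, the center of `L^Λ(M, τ)` is `L^Λ(Z(M), τ_Z)`. -/
theorem proposition2p1 {H : Type*} [NormedAddCommGroup H] [InnerProductSpace ℂ H]
    [CompleteSpace H] (M : VonNeumannAlgebra H) (τ : GenArens.FaithfulNormalFiniteTrace M)
    (Λ : Set (ℝ≥0 → ℝ≥0)) (hΛ : GenArens.IsQuadraticFamily Λ) :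
    GenArens.strongCenter (GenArens.generalizedArens M τ Λ) =
      GenArens.generalizedArens (GenArens.center M)
        (τ.restrict (GenArens.center M) (GenArens.center_le M)) Λ := by
  open GenArens in
  obtain ⟨φ₀, hφ₀⟩ := hΛ.nonempty
  apply Set.Subset.antisymm
  · rintro x ⟨hx, hcomm⟩
    have hxM := Set.mem_iInter₂.1 hx
    have hcl := (orliczSpace_spec (hxM φ₀ hφ₀)).1
    -- Centrality is used only against the unitaries of `M`.
    have hpres : ∀ T ∈ M, Preserves T x := fun T hT => preserves_of_unitary
      (fun u hu huM => preserves_of_strongMul_eq hcl (hcomm _ (Set.mem_iInter₂.2 fun φ hφ =>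
        unitary_mem_orliczSpace (hΛ.isYoung φ hφ) hu huM))) hT
    refine Set.mem_iInter₂.2 fun φ hφ => ?_
    have h1 := hxM φ hφ
    simp only [orliczSpace, Set.mem_iUnion] at h1 ⊢
    obtain ⟨n, hn, x', hx', rfl⟩ := h1
    have hn0 : (n : ℂ) ≠ 0 := Nat.cast_ne_zero.2 (by omega)
    exact ⟨n, hn, x', mem_orliczBall_center hx' fun T hT => (hpres T hT).of_smul_right hn0, rfl⟩
  · intro x hx
    have hxZ := Set.mem_iInter₂.1 hx
    refine ⟨Set.mem_iInter₂.2 fun φ hφ => ?_, fun y hy => ?_⟩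
    · have h1 := hxZ φ hφ
      simp only [orliczSpace, Set.mem_iUnion] at h1 ⊢
      obtain ⟨n, hn, h2⟩ := h1
      exact ⟨n, hn, Set.smul_set_mono (orliczBall_center_subset M τ φ) h2⟩
    · obtain ⟨-, hxZ', hxcut⟩ := orliczSpace_spec (hxZ φ₀ hφ₀)
      obtain ⟨hycl, hyM, hycut⟩ := orliczSpace_spec (Set.mem_iInter₂.1 hy φ₀ hφ₀)
      have hMZ : ∀ T ∈ M, T ∈ (center M).commutant := by
        intro T hT
        rw [VonNeumannAlgebra.mem_commutant_iff]
        exact fun g hg => (VonNeumannAlgebra.mem_commutant_iff.1 hg.2 T hT).symm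
      -- The cutoffs of `x` lie in `Z(M) ⊆ M'` and so commute with `y`; those of `y` lie in `M ⊆
      -- Z(M)'` and so commute with `x`.
      exact strongMul_comm hxcut hycut (fun T hT => hxZ' T (hMZ T hT.1))
        (fun T hT => hyM T hT.2) (fun T hT => hxZ' T (hMZ T hT)) hycl
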